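/- **Conventions.** For a polynomial $H$ on $\mathbb{C}^2$, its bifurcation set $\mathfrak{B}(H)\subset\mathbb{C}$ consists of the critical values of $H$ together with the values near which $H$ is not a locally trivial $C^\infty$ fibration. A value $c\notin\mathfrak{B}(H)$ is generic and $L_c=\{H=c\}$ is then a generic fibre. A *cycle* in $L_c$ is a non-contractible loop, considered up to free homotopy. Cycles $\gamma_1,\dots,\gamma_{\mathfrak r}$ in a path connected space $X$ *generate* $\pi_1(X)$ if for every base point $x$ they are represented, up to free homotopy, by loops based at $x$ whose classes generate $\pi_1(X,x)$. Cycles $\gamma_{i}(c)$, given for all generic $c$, are *global generators* if the generic fibres are path connected, the loops depend continuously on $c$, and they generate $\pi_1$ of every generic fibre. $\mathcal{A}b(\gamma)$ denotes the class of a loop $\gamma$ in $H_1(\,\cdot\,,\mathbb{Z})$. **Normal forms.** Let $\mathcal{H}$ be a polynomial in one of the families $$\mathfrak{F}_1:\ \mathcal{H}=\mathcal{G}+x^{p_1}\mathcal{S}^{p}\prod_{i=1}^{r-1}(\beta_i-\mathcal{G})^{a_i}\ (r\ge 2),\qquad \mathfrak{F}_2:\ \mathcal{H}=x^{p_1}\mathcal{S}^{p}\prod_{i=1}^{r-1}(\beta_i-\mathcal{G})^{a_i}\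 (r\ge 1),$$ where $\mathcal{S}=x^ky+P(x)$, $k\ge 1$, $\deg P\le k-1$, $\mathcal{G}=x^{q_1}\mathcal{S}^{q}$, $0\le p_1<p$, $0\le q_1<q$, $pq_1-qp_1=\pm1$; or $$\mathfrak{F}_3:\ \mathcal{H}=y\prod_{i=1}^{r-1}(\beta_i-x)^{a_i}+h(x)\ (r\ge 1),\qquad \deg h<\sum_i a_i,\qquad \mathcal{G}=x.$$ Here the $a_i$ are positive integers and the $\beta_i$ are distinct points of $\mathbb{C}^*$. In $\mathfrak{F}_2$ with $r=1$ and $p_1=0$ (so that $\mathcal{H}=x^ky+P(x)$) the additive constant is normalized by $P(0)=0$. Let $\mathcal{R}=(\mathcal{G},\mathcal{H})\colon\mathbb{C}^2_{x,y}\to\mathbb{C}^2_{t,\mathfrak{c}}$ be the rectifying map. For a generic value $\mathfrak{c}$ of $\mathcal{H}$ the finite punctures of the rectified line at height $\mathfrak c$ are $\{0,\beta_1,\dots,\beta_{r-1},\mathfrak{c}\}$, $\{0,\beta_1,\dots,\beta_{r-1}\}$, $\{\beta_1,\dots,\beta_{r-1}\}$, according as the family is $\mathfrak{F}_1,\mathfrak{F}_2,\mathfrak{F}_3$.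 Number them $b_1(\mathfrak{c}),\dots,b_{\mathfrak r}(\mathfrak{c})$; thus $\mathfrak{r}=r+1,\,r,\,r-1$. **Proposition (canonical global generators).** For every generic value $\mathfrak c$ of $\mathcal{H}$, $\mathcal{R}$ maps $\mathcal{L}_{\mathfrak c}=\{\mathcal{H}=\mathfrak{c}\}$ bijectively onto the punctured line $\big(\mathbb{C}\setminus\{b_1(\mathfrak{c}),\dots,b_{\mathfrak r}(\mathfrak{c})\}\big)\times\{\mathfrak{c}\}$. There are positive functions $\rho_i(\mathfrak{c})$ $(1\le i\le\mathfrak r)$, continuous on the set of generic values of $\mathcal H$, with $\rho_i(\mathfrak c)<|b_i(\mathfrak c)-b_j(\mathfrak c)|$ for all $j\ne i$. For every such choice let $\alpha_i(\mathfrak{c})$ be the circle of centre $b_i(\mathfrak c)$ and radius $\rho_i(\mathfrak c)$ in the line at height $\mathfrak c$, run through once anticlockwise (so it encloses exactly one of the finite punctures). Then: 1. The $\alpha_i(\mathfrak c)$, $1\le i\le\mathfrak r$, are cycles of $d\mathfrak{c}=0$ and are global generators of $\pi_1$ of the punctured lines $\mathcal{R}(\mathcal{L}_{\mathfrak c})$,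 $\mathfrak c$ generic. For each $\mathfrak c$ the classes $\mathcal{A}b(\alpha_i(\mathfrak c))$ form a basis of $H_1(\mathcal{R}(\mathcal{L}_{\mathfrak c}),\mathbb{Z})\cong\mathbb{Z}^{\mathfrak r}$. 2. The loops $\delta_i(\mathfrak c)=\mathcal{R}^{-1}(\alpha_i(\mathfrak c))$, $1\le i\le\mathfrak r$, are cycles of $d\mathcal{H}=0$ and are global generators of $\pi_1(\mathcal{L}_{\mathfrak c})$, $\mathfrak c$ generic. For each $\mathfrak c$ the classes $\mathcal{A}b(\delta_i(\mathfrak c))$ form a basis of $H_1(\mathcal{L}_{\mathfrak c},\mathbb{Z})$. 3. Let $H$ be a polynomial having $\mathcal H$ as its normal form, that is, $\mathcal{H}=\sigma\circ H\circ\psi^{-1}$ with polynomial automorphisms $\psi\in\mathrm{Aut}(\mathbb{C}^2)$ and $\sigma\in\mathrm{Aut}(\mathbb{C})$. Then the loops $\gamma_i(c)=\psi^{-1}(\delta_i(\sigma(c)))$, $1\le i\le\mathfrak r$, are cycles of $dH=0$ and are global generators of $\pi_1(L_c)$, $c$ a generic value of $H$. For each $c$ the classes $\mathcal{A}b(\gamma_i(c))$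 form a basis of $H_1(L_c,\mathbb{Z})$. -/

import Mathlib

open CategoryTheory
open scoped ContDiff

noncomputable section

namespace CanonicalCycles

/-! ### Polynomials in two variables, fibres, polynomial automorphisms -/

/-- Complex polynomials in two variables. -/
abbrev Poly2 : Type := MvPolynomial (Fin 2) ℂ

/-- The polynomial function `ℂ² → ℂ` defined by a polynomial in two variables. -/
def ev (H : Poly2) (z : ℂ × ℂ) : ℂ := MvPolynomial.eval ![z.1, z.2] H

/-- The fibre `{H = c}` in `ℂ²`. -/
def fiber (H : Poly2) (c : ℂ) : Set (ℂ × ℂ) := {z | ev H z = c}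

/-- `f : ℂ² → ℂ²` is a polynomial map. -/
def IsPolyMap (f : ℂ × ℂ → ℂ × ℂ) : Prop :=
  ∃ A B : Poly2, ∀ z, f z = (ev A z, ev B z)

/-- `ψ` is a polynomial automorphism of `ℂ²`. -/
def IsPolyAut2 (ψ : ℂ × ℂ ≃ ℂ × ℂ) : Prop := IsPolyMap ψ ∧ IsPolyMap ψ.symm

/-- `σ` is a polynomial automorphism of `ℂ`. -/
def IsPolyAut1 (σ : ℂ ≃ ℂ) : Prop :=
  (∃ f : Polynomial ℂ, ∀ c, σ c = f.eval c) ∧ ∃ f : Polynomial ℂ, ∀ c, σ.symm c = f.eval c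

/-! ### The bifurcation set -/

/-- Smoothness (in the real sense) of a map on an arbitrary subset `S`: locally on `S` the map is
the restriction of a smooth map defined on an open set. -/
def SmoothOnSubset {E F : Type*} [NormedAddCommGroup E] [NormedSpace ℝ E]
    [NormedAddCommGroup F] [NormedSpace ℝ F] (f : E → F) (S : Set E) : Prop :=
  ∀ x ∈ S, ∃ V : Set E, IsOpen V ∧ x ∈ V ∧ ∃ g : E → F, ContDiffOn ℝ ∞ g V ∧ Set.EqOn f g (V ∩ S)

/-- The finite critical values of `H`. -/
def criticalValues (H : Poly2) : Set ℂ :=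
  {c | ∃ z, ev H z = c ∧ ev (MvPolynomial.pderiv 0 H) z = 0 ∧ ev (MvPolynomial.pderiv 1 H) z = 0}

/-- Over some neighbourhood `U` of `c`, the map `H` is a trivial smooth fibration: there is a
diffeomorphism `w ↦ (H w, Φ w)` from `H⁻¹(U)` onto `U × {H = c}`, with inverse `Ψ`. -/
def LocallyTrivialAt (H : Poly2) (c : ℂ) : Prop :=
  ∃ (U : Set ℂ) (Φ : ℂ × ℂ → ℂ × ℂ) (Ψ : ℂ × (ℂ × ℂ) → ℂ × ℂ),
    IsOpen U ∧ c ∈ U ∧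
    SmoothOnSubset Φ (ev H ⁻¹' U) ∧ SmoothOnSubset Ψ (U ×ˢ fiber H c) ∧
    (∀ w, ev H w ∈ U → Φ w ∈ fiber H c ∧ Ψ (ev H w, Φ w) = w) ∧
    (∀ u ∈ U, ∀ z ∈ fiber H c, ev H (Ψ (u, z)) = u ∧ Φ (Ψ (u, z)) = z)

/-- The bifurcation set `𝔅(H)`: the finite critical values, together with the values (coming from
infinity) near which `H` is not a locally trivial smooth fibration. -/
def bifurcationSet (H : Poly2) : Set ℂ := criticalValues H ∪ {c | ¬ LocallyTrivialAt H c}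

/-- The generic values of `H`. -/
def genericValues (H : Poly2) : Set ℂ := (bifurcationSet H)ᶜ

/-! ### The three families of normal forms, and their rectifying maps

The parameter `n` below is `r - 1`, the number of the points `β₁, …, β_{r-1}`. -/

/-- The parameters shared by the first and the second family. -/
structure ParamS (n : ℕ) where
  β : Fin n → ℂ
  a : Fin n → ℕ
  p : ℕ
  p₁ : ℕ
  q : ℕ
  q₁ : ℕ
  k : ℕ
  P : Polynomial ℂ
  β_inj : Function.Injective β
  β_ne : ∀ i, β i ≠ 0
  a_pos : ∀ i, 0 < a i
  p₁_lt : p₁ < p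
  q₁_lt : q₁ < q
  det : (p * q₁ : ℤ) - q * p₁ = 1 ∨ (p * q₁ : ℤ) - q * p₁ = -1
  k_pos : 1 ≤ k
  P_deg : P.degree < k

/-- The parameters of the third family. -/
structure ParamH (n : ℕ) where
  β : Fin n → ℂ
  a : Fin n → ℕ
  h : Polynomial ℂ
  β_inj : Function.Injective β
  β_ne : ∀ i, β i ≠ 0
  a_pos : ∀ i, 0 < a i
  h_deg : h.degree < ((∑ i, a i : ℕ) : WithBot ℕ)

namespace ParamS

variable {n : ℕ} (D : ParamS n)

/-- `S(x, y) = x ^ k y + P(x)`. -/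
def S : Poly2 :=
  MvPolynomial.X 0 ^ D.k * MvPolynomial.X 1 + Polynomial.aeval (MvPolynomial.X 0 : Poly2) D.P

/-- `G(x, y) = x ^ q₁ S(x, y) ^ q`. -/
def G : Poly2 := MvPolynomial.X 0 ^ D.q₁ * D.S ^ D.q

/-- `x ^ p₁ S ^ p ∏ (β i - x ^ q₁ S ^ q) ^ a i`. -/
def T : Poly2 :=
  MvPolynomial.X 0 ^ D.p₁ * D.S ^ D.p * ∏ i, (MvPolynomial.C (D.β i) - D.G) ^ D.a i

end ParamS

/-- Data of a member of one of the three families. In the second family with `r = 1` and `p₁ = 0`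
(where `𝓗 = x ^ k y + P(x)`) the additive constant is normalized by `P(0) = 0`. -/
inductive NormalForm : Type
  | one (n : ℕ) (hn : 1 ≤ n) (D : ParamS n)
  | two (n : ℕ) (D : ParamS n) (hD : n = 0 → D.p₁ = 0 → D.P.eval 0 = 0)
  | three (n : ℕ) (D : ParamH n)

namespace NormalForm

/-- The polynomial `𝓗`. -/
def poly : NormalForm → Poly2
  | one _ _ D => D.G + D.T
  | two _ D _ => D.T
  | three _ D =>
      MvPolynomial.X 1 * ∏ i, (MvPolynomial.C (D.β i) - MvPolynomial.X 0) ^ D.a i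
        + Polynomial.aeval (MvPolynomial.X 0 : Poly2) D.h

/-- The first component `𝓖` of the rectifying map. -/
def first : NormalForm → Poly2
  | one _ _ D => D.G
  | two _ D _ => D.G
  | three _ _ => MvPolynomial.X 0

/-- The rectifying map `𝓡 = (𝓖, 𝓗)`. -/
def rect (N : NormalForm) (z : ℂ × ℂ) : ℂ × ℂ := (ev N.first z, ev N.poly z)

/-- The number `𝔯` of finite punctures of the rectified generic lines:
`r + 1`, `r`, `r - 1` in the three families. -/
def rank : NormalForm → ℕ
  | one n _ _ => n + 2
  | two n _ _ => n + 1
  | three n _ => n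

/-- The finite punctures of the rectified line at height `c`:
`0, β₁, …, β_{r-1}, c`, or `0, β₁, …, β_{r-1}`, or `β₁, …, β_{r-1}`. -/
def puncture : (N : NormalForm) → ℂ → Fin N.rank → ℂ
  | one n _ D, c => (Fin.cons 0 (Fin.snoc D.β c : Fin (n + 1) → ℂ) : Fin (n + 2) → ℂ)
  | two n D _, _ => (Fin.cons 0 D.β : Fin (n + 1) → ℂ)
  | three _ D, _ => D.β

/-- The punctured rectified line at height `c`. -/
def line (N : NormalForm) (c : ℂ) : Set (ℂ × ℂ) :=
  {w | w.2 = c ∧ ∀ i, w.1 ≠ N.puncture c i}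

/-- Radii `ρ i c`, depending continuously on the generic value `c`, such that the closed disc of
radius `ρ i c` about the `i`-th puncture contains no other finite puncture. -/
def Admissible (N : NormalForm) (ρ : Fin N.rank → ℂ → ℝ) : Prop :=
  ∀ i, ContinuousOn (ρ i) (genericValues N.poly) ∧
    ∀ c ∈ genericValues N.poly, 0 < ρ i c ∧
      ∀ j, j ≠ i → ρ i c < dist (N.puncture c i) (N.puncture c j)

/-- The cycle `α i c`: the circle of radius `ρ i c` about the `i`-th finite puncture of the
rectified line at height `c`, run through once anticlockwise. -/
def alpha (N : NormalForm) (ρ : Fin N.rank → ℂ → ℝ) (i : Fin N.rank) (c : ℂ) (s : unitInterval) : ℂ × ℂ :=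
  (N.puncture c i + ρ i c * Complex.exp (2 * Real.pi * Complex.I * (s : ℝ)), c)

/-- The inverse of the rectifying map on the fibre `{𝓗 = c}`. -/
def rectInv (N : NormalForm) (c : ℂ) (w : ℂ × ℂ) : ℂ × ℂ :=
  Function.invFunOn N.rect (fiber N.poly c) w

/-- The cycle `δ i c = 𝓡⁻¹(α i c)` in the fibre `{𝓗 = c}`. -/
def delta (N : NormalForm) (ρ : Fin N.rank → ℂ → ℝ) (i : Fin N.rank) (c : ℂ) (s : unitInterval) : ℂ × ℂ :=
  N.rectInv c (N.alpha ρ i c s)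

/-- The cycle `γ i c = ψ⁻¹(δ i (σ c))` in the fibre `{H = c}` of `H = σ⁻¹ ∘ 𝓗 ∘ ψ`. -/
def gamma (N : NormalForm) (ψ : ℂ × ℂ ≃ ℂ × ℂ) (σ : ℂ ≃ ℂ) (ρ : Fin N.rank → ℂ → ℝ)
    (i : Fin N.rank) (c : ℂ) (s : unitInterval) : ℂ × ℂ :=
  ψ.symm (N.delta ρ i (σ c) s)

end NormalForm

/-! ### Loops, free homotopy and first homology -/

section Loops

variable {X : Type} [TopologicalSpace X]

/-- Free homotopy of loops in `X`. -/
def FreelyHomotopic {x y : X} (f : Path x x) (g : Path y y) : Prop :=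
  ∃ F : C(unitInterval × unitInterval, X), (∀ s, F (0, s) = f s) ∧ (∀ s, F (1, s) = g s) ∧ ∀ u, F (u, 0) = F (u, 1)

variable (X) in
/-- The singular chain complex of `X` with integral coefficients. -/
abbrev singChains : ChainComplex (ModuleCat.{0} ℤ) ℕ :=
  ((AlgebraicTopology.singularChainComplexFunctor (ModuleCat.{0} ℤ)).obj
    (ModuleCat.of ℤ ℤ)).obj (TopCat.of X)

variable (X) in
/-- The first singular homology group `H₁(X, ℤ)`. -/
abbrev H1 : ModuleCat.{0} ℤ :=
  ((AlgebraicTopology.singularHomologyFunctor (ModuleCat.{0} ℤ) 1).obj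
    (ModuleCat.of ℤ ℤ)).obj (TopCat.of X)

/-- The singular `1`-simplex of a loop. -/
def loopSimplex {x : X} (f : Path x x) :
    (TopCat.toSSet.obj (TopCat.of X)).obj (Opposite.op (SimplexCategory.mk 1)) :=
  (TopCat.toSSetObjEdgeEquiv.symm ((TopCat.pathEquiv (X := TopCat.of X)).symm f)).edge

/-- The singular `1`-chain of a loop, as the morphism `ℤ ⟶ C₁(X)` sending `1` to that chain. -/
def loopChain {x : X} (f : Path x x) : ModuleCat.of ℤ ℤ ⟶ (singChains X).X 1 :=
  (TopCat.toSSet.obj (TopCat.of X)).ιChainComplex (loopSimplex f)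

theorem loopChain_d {x : X} (f : Path x x) : loopChain f ≫ (singChains X).d 1 0 = 0 := by
  have h := SSet.ιChainComplex_d (TopCat.toSSet.obj (TopCat.of X)) (R := ModuleCat.of ℤ ℤ)
    (loopSimplex f)
  refine h.trans ?_
  have h0 := (TopCat.toSSetObjEdgeEquiv.symm ((TopCat.pathEquiv (X := TopCat.of X)).symm f)).tgt_eq
  have h1 := (TopCat.toSSetObjEdgeEquiv.symm ((TopCat.pathEquiv (X := TopCat.of X)).symm f)).src_eq
  simp [Fin.sum_univ_two, loopSimplex, h0, h1]
  rfl

/-- The class of a loop in `H₁(X, ℤ)`. -/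
def loopClass {x : X} (f : Path x x) : H1 X :=
  ((singChains X).liftCycles (loopChain f) 0 (by simp) (loopChain_d f) ≫
    (singChains X).homologyπ 1).hom (1 : ℤ)

end Loops

/-! ### Global generators -/

/-- `γ i c` (`c ∈ B`) is a global family of cycles in the sets `F c ⊆ ℂ²`, which generate the
fundamental groups of all `F c` and give bases of their first homology groups. A cycle is a
non-contractible loop, taken up to free homotopy: that cycles generate `π₁(F c, x)` means that they
are represented by loops based at `x` whose classes generate this group. -/
structure IsGlobalGenerators {m : ℕ} (B : Set ℂ) (F : ℂ → Set (ℂ × ℂ))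
    (γ : Fin m → ℂ → unitInterval → ℂ × ℂ) : Prop where
  pathConnected : ∀ c ∈ B, IsPathConnected (F c)
  continuous : ∀ i, ContinuousOn (fun v : ℂ × unitInterval => γ i v.1 v.2) (B ×ˢ Set.univ)
  cycles : ∀ c ∈ B, ∃ (y : Fin m → F c) (l : ∀ i, Path (y i) (y i)),
    (∀ i s, (l i s : ℂ × ℂ) = γ i c s) ∧
    (∀ i z, ¬ FreelyHomotopic (l i) (Path.refl z)) ∧
    (∀ x : F c, ∃ g : Fin m → Path x x,
      (∀ i, FreelyHomotopic (g i) (l i)) ∧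
      Subgroup.closure (Set.range fun i =>
        (FundamentalGroup.fromPath (Path.Homotopic.Quotient.mk (g i)) : FundamentalGroup (F c) x))
          = ⊤) ∧
    ∃ b : Module.Basis (Fin m) ℤ (H1 (F c)), ∀ i, b i = loopClass (l i)

end CanonicalCycles

end

/-! The fibres are straightened by an explicit formula. In the first two families write `𝓗 = κ G +
x^p₁ S^p Q(G)` with `κ = 1` or `κ = 0` and `Q(t) = ∏ (β i - t)^(a i)`. On `{𝓗 = c}` the value `t =
G` determines `u = x^p₁ S^p = (c - κ t) / Q(t)`. The exponents in `t = x^q₁ S^q` and `u` form a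
matrix of determinant `±1`, so `(x, S)` is a pair of Laurent monomials in `(t, u)`, and `y` is
recovered from `S` because `x ≠ 0`. This works when `t` avoids `0`, the `β i` and the zero of `c - κ
t`, which are exactly the finite punctures. In the third family the fibre is a graph over the
`x`-line without the `β i`. The structure `Rectified` records such an inverse, valid for `c` outside
the set `exc` of values taken where a factor `x`, `S` or `β i - G` (in the third family `β i - x`)
vanishes.

It remains to see that every value in `exc` is a bifurcation value (`mem_bifurcationSet_of_factor`).
At such a value `c` one has `𝓗 - c = A B` where both factors have zeros. If `𝓗` were locally trivial
at `c`, the fibre over `c` would be a continuous image of a nearby rectified fibre, hence connected;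
the closed sets `{A = 0}` and `{B = 0}` would then meet, and at a common zero `d𝓗 = 0`, so `c` would
be critical.

The topology is that of a plane without finitely many points. Small circles about the punctures
generate the fundamental group: convex open sets are cut into two overlapping half-plane pieces, and
the generation half of van Kampen's theorem (`eq_top_of_union`) is applied inductively
(`circlesGenerate_convex_diff`). Generators of `π₁` span `H₁` (`span_loopClass_eq_top`). Winding
numbers about the punctures, defined as variations of continuous logarithms, give linear forms on
`H₁` dual to the circles up to the factor `2πi`; hence the circles are not contractible and their
classes form a basis (`cycles_of_generate`). Homeomorphisms carry all this to the fibres of `𝓗` and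
of its conjugates. -/

noncomputable section

namespace CanonicalCycles

open scoped unitInterval Simplicial

/-! ### Singular chains of paths and boundaries of triangles -/

section Chains

variable {X : Type} [TopologicalSpace X]

/-- The singular `1`-simplex of a path. -/
def pathSimplex {x y : X} (f : Path x y) :
    (TopCat.toSSet.obj (TopCat.of X)).obj (Opposite.op (SimplexCategory.mk 1)) :=
  (TopCat.toSSetObjEdgeEquiv.symm ((TopCat.pathEquiv (X := TopCat.of X)).symm f)).edge

/-- The `n`-chain of a singular `n`-simplex. -/
def simplexChain {n : ℕ} (s : (TopCat.toSSet.obj (TopCat.of X)).obj (Opposite.op (SimplexCategory.mk n))) :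
    (singChains X).X n :=
  ((TopCat.toSSet.obj (TopCat.of X)).ιChainComplex s :
    ModuleCat.of ℤ ℤ ⟶ (singChains X).X n).hom (1 : ℤ)

/-- The singular `1`-chain of a path. -/
def pathChain {x y : X} (f : Path x y) : (singChains X).X 1 := simplexChain (pathSimplex f)

/-- The singular `0`-chain of a point. -/
def pointChain (x : X) : (singChains X).X 0 :=
  simplexChain ((TopCat.toSSetObj₀Equiv (X := TopCat.of X)).symm x)

/-- A morphism out of `ℤ` is determined by its value at `1`; evaluating the categorical face formula
there gives an identity between actual chains. -/
theorem d_simplexChain {n : ℕ}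
    (s : (TopCat.toSSet.obj (TopCat.of X)).obj (Opposite.op (SimplexCategory.mk (n + 1)))) :
    (singChains X).d (n + 1) n (simplexChain s) =
      ∑ i : Fin (n + 2), (-1 : ℤ) ^ i.val •
        simplexChain ((TopCat.toSSet.obj (TopCat.of X)).δ i s) := by
  have h := SSet.ιChainComplex_d (TopCat.toSSet.obj (TopCat.of X)) (R := ModuleCat.of ℤ ℤ) s
  have h' := congrArg (fun g => g.hom (1 : ℤ)) h
  simp only [ModuleCat.hom_comp, LinearMap.comp_apply] at h'
  refine h'.trans ?_
  simp [simplexChain, ModuleCat.hom_sum]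
  rfl

theorem d_pathChain {x y : X} (f : Path x y) :
    (singChains X).d 1 0 (pathChain f) = pointChain y - pointChain x := by
  have h0 := (TopCat.toSSetObjEdgeEquiv.symm ((TopCat.pathEquiv (X := TopCat.of X)).symm f)).tgt_eq
  have h1 := (TopCat.toSSetObjEdgeEquiv.symm ((TopCat.pathEquiv (X := TopCat.of X)).symm f)).src_eq
  rw [pathChain, d_simplexChain]
  simp [Fin.sum_univ_two, pathSimplex, h0, h1, pointChain, sub_eq_add_neg]

theorem exists_pathSimplex
    (s : (TopCat.toSSet.obj (TopCat.of X)).obj (Opposite.op (SimplexCategory.mk 1))) :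
    ∃ (x y : X) (f : Path x y), pathSimplex f = s := by
  let p := (TopCat.toSSetObj₁Equiv s)
  refine ⟨p 0, p 1, TopCat.pathEquiv (X := TopCat.of X) ⟨p, rfl, rfl⟩, ?_⟩
  exact TopCat.toSSetObj₁Equiv.symm_apply_apply s

/-- The path along an edge of a singular simplex. -/
def simplexEdge {n : ℕ} (g : C(stdSimplex ℝ (Fin n), X)) (i j : Fin n) :
    Path (g (stdSimplex.vertex i)) (g (stdSimplex.vertex j)) where
  toFun t := g (stdSimplex.map ![i, j] (stdSimplexHomeomorphUnitInterval.symm t))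
  continuous_toFun := g.continuous.comp ((stdSimplex.continuous_map _).comp
    stdSimplexHomeomorphUnitInterval.symm.continuous)
  source' := by
    rw [← stdSimplexHomeomorphUnitInterval_zero, Homeomorph.symm_apply_apply]
    exact congrArg g (stdSimplex.map_vertex _ _)
  target' := by
    rw [← stdSimplexHomeomorphUnitInterval_one, Homeomorph.symm_apply_apply]
    exact congrArg g (stdSimplex.map_vertex _ _)

theorem pathSimplex_eq {x y : X} (f : Path x y) :
    pathSimplex f = ((TopCat.of X).toSSetObjEquiv (Opposite.op (SimplexCategory.mk 1))).symm
      (f.toContinuousMap.comp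
        ⟨stdSimplexHomeomorphUnitInterval, stdSimplexHomeomorphUnitInterval.continuous⟩) := by
  rfl

/-- Paths are parametrized by the unit interval and simplices by `stdSimplex`; once the two
reparametrizations cancel, an edge can be matched with a face in `d_triangle`. -/
theorem pathSimplex_simplexEdge {n : ℕ} (g : C(stdSimplex ℝ (Fin n), X)) (i j : Fin n) :
    pathSimplex (simplexEdge g i j) =
      ((TopCat.of X).toSSetObjEquiv (Opposite.op (SimplexCategory.mk 1))).symm
        (g.comp ⟨stdSimplex.map ![i, j], stdSimplex.continuous_map _⟩) := by
  rw [pathSimplex_eq]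
  congr 1
  ext s
  simp [simplexEdge]

/-- The boundary of a singular `2`-simplex. -/
theorem d_triangle (g : C(stdSimplex ℝ (Fin 3), X)) :
    (singChains X).d 2 1 (simplexChain
      (((TopCat.of X).toSSetObjEquiv (Opposite.op (SimplexCategory.mk 2))).symm g)) =
    pathChain (simplexEdge g 1 2) - pathChain (simplexEdge g 0 2)
      + pathChain (simplexEdge g 0 1) := by
  rw [d_simplexChain, Fin.sum_univ_three]
  simp only [pathChain, pathSimplex_simplexEdge]
  have h0 : ((0 : Fin 3).succAbove : Fin 2 → Fin 3) = ![1, 2] := by decide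
  have h1 : ((1 : Fin 3).succAbove : Fin 2 → Fin 3) = ![0, 2] := by decide
  have h2 : ((2 : Fin 3).succAbove : Fin 2 → Fin 3) = ![0, 1] := by decide
  have e : ∀ a b c : (singChains X).X 1, (-1 : ℤ) ^ (0 : Fin 3).val • a
      + (-1 : ℤ) ^ (1 : Fin 3).val • b + (-1 : ℤ) ^ (2 : Fin 3).val • c = a - b + c := by
    intro a b c
    simp [sub_eq_add_neg]
  have k : ∀ (i : Fin 3) (v : Fin 2 → Fin 3), i.succAbove = v →
      (TopCat.toSSet.obj (TopCat.of X)).δ i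
        (((TopCat.of X).toSSetObjEquiv (Opposite.op (SimplexCategory.mk 2))).symm g) =
      ((TopCat.of X).toSSetObjEquiv (Opposite.op (SimplexCategory.mk 1))).symm
        (g.comp ⟨stdSimplex.map v, stdSimplex.continuous_map _⟩) := by
    rintro i v rfl
    rfl
  rw [e, k 0 _ h0, k 1 _ h1, k 2 _ h2]

theorem exists_triangle
    (s : (TopCat.toSSet.obj (TopCat.of X)).obj (Opposite.op (SimplexCategory.mk 2))) :
    ∃ g : C(stdSimplex ℝ (Fin 3), X),
      ((TopCat.of X).toSSetObjEquiv (Opposite.op (SimplexCategory.mk 2))).symm g = s :=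
  ⟨_, Equiv.symm_apply_apply _ s⟩

/-- The span of the chains of simplices is everything. -/
theorem chains_induction {n : ℕ} {M : Type} [AddCommGroup M] [Module ℤ M]
    {f g : (singChains X).X n →ₗ[ℤ] M} (h : ∀ s, f (simplexChain s) = g (simplexChain s)) :
    f = g := by
  have : (ModuleCat.ofHom f : (singChains X).X n ⟶ ModuleCat.of ℤ M) = ModuleCat.ofHom g := by
    apply SSet.chainComplex_hom_ext (X := TopCat.toSSet.obj (TopCat.of X)) (R := ModuleCat.of ℤ ℤ)
    intro s
    ext
    exact h s
  exact congrArg ModuleCat.Hom.hom this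

/-- Linear maps on singular chains with given values on simplices. -/
theorem exists_chains_desc {n : ℕ} {M : Type} [AddCommGroup M] [Module ℤ M]
    (v : (TopCat.toSSet.obj (TopCat.of X)).obj (Opposite.op (SimplexCategory.mk n)) → M) :
    ∃ f : (singChains X).X n →ₗ[ℤ] M, ∀ s, f (simplexChain s) = v s := by
  let c := Limits.Cofan.IsColimit.desc
    ((TopCat.toSSet.obj (TopCat.of X)).isColimitChainComplexXCofan (ModuleCat.of ℤ ℤ) n)
    (A := ModuleCat.of ℤ M) (fun s => ModuleCat.ofHom (LinearMap.toSpanSingleton ℤ M (v s)))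
  refine ⟨c.hom, fun s => ?_⟩
  have h := Limits.Cofan.IsColimit.fac
    ((TopCat.toSSet.obj (TopCat.of X)).isColimitChainComplexXCofan (ModuleCat.of ℤ ℤ) n)
    (A := ModuleCat.of ℤ M) (fun s => ModuleCat.ofHom (LinearMap.toSpanSingleton ℤ M (v s))) s
  have h' := congrArg (fun g => g.hom (1 : ℤ)) h
  exact Eq.trans h' (LinearMap.toSpanSingleton_apply_one ℤ M (v s))

/-- The subgroup of boundaries in degree one. -/
def boundaries (X : Type) [TopologicalSpace X] : Submodule ℤ ((singChains X).X 1) :=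
  LinearMap.range ((singChains X).d 2 1).hom

end Chains
end CanonicalCycles
end

noncomputable section

namespace CanonicalCycles

open scoped unitInterval Simplicial

/-! ### Cycles, classes and cochains in degree one -/

section Homology

variable {X : Type} [TopologicalSpace X]

/-- The singular cycle of a loop. -/
def loopCycle {x : X} (f : Path x x) : (singChains X).cycles 1 :=
  (singChains X).liftCycles (loopChain f) 0 (by simp) (loopChain_d f) (1 : ℤ)

theorem iCycles_loopCycle {x : X} (f : Path x x) :
    (singChains X).iCycles 1 (loopCycle f) = pathChain f :=
  congrArg (fun g => g.hom (1 : ℤ))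
    ((singChains X).liftCycles_i (loopChain f) 0 (by simp) (loopChain_d f))

theorem homologyπ_loopCycle {x : X} (f : Path x x) :
    (singChains X).homologyπ 1 (loopCycle f) = loopClass f := rfl

theorem iCycles_injective : Function.Injective ((singChains X).iCycles 1) :=
  (ModuleCat.mono_iff_injective ((singChains X).iCycles 1)).1 inferInstance

theorem homologyπ_surjective : Function.Surjective ((singChains X).homologyπ 1) :=
  (ModuleCat.epi_iff_surjective ((singChains X).homologyπ 1)).1 inferInstance

theorem d_iCycles (y : (singChains X).cycles 1) :
    (singChains X).d 1 0 ((singChains X).iCycles 1 y) = 0 :=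
  congrArg (fun g => g.hom y) ((singChains X).iCycles_d 1 0)

theorem homologyπ_eq_zero {y : (singChains X).cycles 1}
    (hy : (singChains X).iCycles 1 y ∈ boundaries X) : (singChains X).homologyπ 1 y = 0 := by
  obtain ⟨w, hw⟩ := hy
  have : y = (singChains X).toCycles 2 1 w := by
    apply iCycles_injective
    exact hw.symm.trans (congrArg (fun g => g.hom w) ((singChains X).toCycles_i 2 1)).symm
  rw [this]
  exact congrArg (fun g => g.hom w) ((singChains X).toCycles_comp_homologyπ 2 1)

/-- A cochain which vanishes on boundaries induces a linear map on homology. -/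
theorem exists_H1_desc {M : Type} [AddCommGroup M] [Module ℤ M] (φ : (singChains X).X 1 →ₗ[ℤ] M)
    (hφ : ∀ w, φ ((singChains X).d 2 1 w) = 0) :
    ∃ Φ : H1 X →ₗ[ℤ] M, ∀ y : (singChains X).cycles 1,
      Φ ((singChains X).homologyπ 1 y) = φ ((singChains X).iCycles 1 y) := by
  let k : (singChains X).X 1 ⟶ ModuleCat.of ℤ M := ModuleCat.ofHom φ
  have hk : (singChains X).d 2 1 ≫ k = 0 := by
    ext w
    exact hφ w
  refine ⟨((singChains X).homologyι 1 ≫ (singChains X).descOpcycles k 2 (by simp) hk).hom, ?_⟩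
  intro y
  have : (singChains X).homologyπ 1 ≫
      ((singChains X).homologyι 1 ≫ (singChains X).descOpcycles k 2 (by simp) hk) =
      (singChains X).iCycles 1 ≫ k := by
    simp
  exact congrArg (fun g => g.hom y) this

end Homology

/-! ### Homologies given by affine triangles -/

section Hurewicz

variable {X : Type} [TopologicalSpace X]

/-- The image of a segment under a continuous map of the plane. -/
def segPath (F : C(ℝ × ℝ, X)) (p q : ℝ × ℝ) : Path (F p) (F q) where
  toFun t := F (AffineMap.lineMap p q (t : ℝ))
  continuous_toFun := by
    refine F.continuous.comp ?_
    exact AffineMap.lineMap_continuous.comp continuous_subtype_val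
  source' := by simp
  target' := by simp

theorem pathChain_congr {x y x' y' : X} {f : Path x y} {g : Path x' y'} (h : ∀ t, f t = g t) :
    pathChain f = pathChain g := by
  obtain rfl : x = x' := by simpa using h 0
  obtain rfl : y = y' := by simpa using h 1
  congr
  ext t
  exact h t

/-- The segments are the edges of an affine triangle pushed forward by `F`. Its vertices are
arbitrary, so flat triangles also yield the relations for constant and concatenated paths. -/
theorem segPath_triangle (F : C(ℝ × ℝ, X)) (p q r : ℝ × ℝ) :
    pathChain (segPath F q r) - pathChain (segPath F p r) + pathChain (segPath F p q)
      ∈ boundaries X := by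
  let a : C(stdSimplex ℝ (Fin 3), ℝ × ℝ) :=
    ⟨fun s => s 0 • p + s 1 • q + s 2 • r, by
      have h : ∀ i : Fin 3, Continuous fun s : stdSimplex ℝ (Fin 3) => s i := fun i =>
        (continuous_apply i).comp continuous_subtype_val
      exact (((h 0).smul continuous_const).add ((h 1).smul continuous_const)).add
        ((h 2).smul continuous_const)⟩
  refine ⟨simplexChain (((TopCat.of X).toSSetObjEquiv
    (Opposite.op (SimplexCategory.mk 2))).symm (F.comp a)), ?_⟩
  refine (d_triangle _).trans ?_
  have key : ∀ (i j : Fin 3) (t : I), simplexEdge (F.comp a) i j t =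
      F (AffineMap.lineMap (![p, q, r] i) (![p, q, r] j) (t : ℝ)) := by
    intro i j t
    change F _ = F _
    congr 1
    have hm : ∀ k : Fin 3, (stdSimplex.map ![i, j] (stdSimplexHomeomorphUnitInterval.symm t)) k =
        (if i = k then 1 - (t : ℝ) else 0) + (if j = k then (t : ℝ) else 0) := by
      intro k
      simp [FunOnFinite.linearMap_apply_apply, Finset.sum_filter, Fin.sum_univ_two]
      rfl
    have : a (stdSimplex.map ![i, j] (stdSimplexHomeomorphUnitInterval.symm t)) =
      ∑ k, (stdSimplex.map ![i, j] (stdSimplexHomeomorphUnitInterval.symm t)) k • ![p, q, r] k := by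
      simp [a, Fin.sum_univ_three]
    refine this.trans ?_
    simp [hm, add_smul, Finset.sum_add_distrib, AffineMap.lineMap_apply_module, ite_smul]
  refine congrArg₂ _ (congrArg₂ _ ?_ ?_) ?_
  · exact pathChain_congr (key 1 2)
  · exact pathChain_congr (key 0 2)
  · exact pathChain_congr (key 0 1)

end Hurewicz
end CanonicalCycles
end

noncomputable section

namespace CanonicalCycles

open scoped unitInterval Simplicial

/-! ### From the fundamental group to first homology -/

section Hurewicz

variable {X : Type} [TopologicalSpace X]

/-- The boundary of a singular square. -/
theorem square_mem_boundaries (F : C(I × I, X)) {x y z w : X} (a : Path x y) (b : Path y w)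
    (c : Path x z) (d : Path z w) (ha : ∀ t, F (0, t) = a t) (hb : ∀ t, F (t, 1) = b t)
    (hc : ∀ t, F (t, 0) = c t) (hd : ∀ t, F (1, t) = d t) :
    pathChain a + pathChain b - (pathChain c + pathChain d) ∈ boundaries X := by
  -- Clamping the coordinates extends `F` to the plane. The square is then cut along the diagonal
  -- from `(0, 0)` to `(1, 1)`, whose chain cancels.
  let G : C(ℝ × ℝ, X) := F.comp
    ⟨fun p => (Set.projIcc 0 1 zero_le_one p.1, Set.projIcc 0 1 zero_le_one p.2), by fun_prop⟩
  have hG : ∀ s t : I, G ((s : ℝ), (t : ℝ)) = F (s, t) := fun s t => by simp [G]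
  have e0 : ∀ t : I, G (0, (t : ℝ)) = F (0, t) := fun t => hG 0 t
  have e1 : ∀ t : I, G (1, (t : ℝ)) = F (1, t) := fun t => hG 1 t
  have e2 : ∀ t : I, G ((t : ℝ), 0) = F (t, 0) := fun t => hG t 0
  have e3 : ∀ t : I, G ((t : ℝ), 1) = F (t, 1) := fun t => hG t 1
  have h1 := segPath_triangle G (0, 0) (0, 1) (1, 1)
  have h2 := segPath_triangle G (0, 0) (1, 0) (1, 1)
  have ka : pathChain (segPath G (0, 0) (0, 1)) = pathChain a := pathChain_congr fun t => by
    simp [segPath, AffineMap.lineMap_apply, e0, ha]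
  have kb : pathChain (segPath G (0, 1) (1, 1)) = pathChain b := pathChain_congr fun t => by
    simp [segPath, AffineMap.lineMap_apply, e3, hb]
  have kc : pathChain (segPath G (0, 0) (1, 0)) = pathChain c := pathChain_congr fun t => by
    simp [segPath, AffineMap.lineMap_apply, e2, hc]
  have kd : pathChain (segPath G (1, 0) (1, 1)) = pathChain d := pathChain_congr fun t => by
    simp [segPath, AffineMap.lineMap_apply, e1, hd]
  rw [ka, kb] at h1
  rw [kc, kd] at h2
  have h3 := (boundaries X).sub_mem h1 h2
  convert h3 using 1
  abel

/-- A constant triangle has boundary `c - c + c = c`. -/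
theorem pathChain_refl_mem (x : X) : pathChain (Path.refl x) ∈ boundaries X := by
  have h := segPath_triangle (ContinuousMap.const _ x) (0, 0) (0, 0) (0, 0)
  have e : pathChain (segPath (ContinuousMap.const _ x) (0, 0) (0, 0)) =
      pathChain (Path.refl x) := pathChain_congr fun t => rfl
  rw [e] at h
  simpa using h

/-- The flat triangle with vertices at parameters `0`, `1 / 2`, `1` of the concatenation has edges
`f`, `g` and `f.trans g`. -/
theorem pathChain_trans_mem {x y z : X} (f : Path x y) (g : Path y z) :
    pathChain (f.trans g) - (pathChain f + pathChain g) ∈ boundaries X := by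
  let F : C(ℝ × ℝ, X) := ⟨fun p => (f.trans g).extend p.1, by fun_prop⟩
  have h := segPath_triangle F (0, 0) (1 / 2, 0) (1, 0)
  have k1 : pathChain (segPath F (0, 0) (1 / 2, 0)) = pathChain f := pathChain_congr fun t => by
    have ht := t.2
    simp only [segPath, Path.coe_mk', ContinuousMap.coe_mk, F, AffineMap.lineMap_apply]
    simp only [vsub_eq_sub, vadd_eq_add, Prod.fst_add, Prod.smul_fst, Prod.fst_sub, smul_eq_mul]
    rw [Path.extend_apply (f.trans g) (t := (t : ℝ) * (1 / 2 - 0) + 0)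
      ⟨by linarith [ht.1], by linarith [ht.2]⟩, Path.trans_apply, dif_pos (by
        change (t : ℝ) * (1 / 2 - 0) + 0 ≤ 1 / 2; linarith [ht.2])]
    congr 1
    ext
    change 2 * ((t : ℝ) * (1 / 2 - 0) + 0) = t
    ring
  have k2 : pathChain (segPath F (1 / 2, 0) (1, 0)) = pathChain g := pathChain_congr fun t => by
    have ht := t.2
    simp only [segPath, Path.coe_mk', ContinuousMap.coe_mk, F, AffineMap.lineMap_apply]
    simp only [vsub_eq_sub, vadd_eq_add, Prod.fst_add, Prod.smul_fst, Prod.fst_sub, smul_eq_mul]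
    have hm : (t : ℝ) * (1 - 1 / 2) + 1 / 2 ∈ I := ⟨by linarith [ht.1], by linarith [ht.2]⟩
    rw [Path.extend_apply (f.trans g) hm]
    -- At the junction `1 / 2` the concatenation is evaluated through its first half, so the initial
    -- point of `g` is treated separately.
    by_cases h0 : (t : ℝ) = 0
    · have : (⟨(t : ℝ) * (1 - 1 / 2) + 1 / 2, hm⟩ : I) = ⟨1 / 2, by norm_num, by norm_num⟩ := by
        ext; simp [h0]
      rw [this, Path.trans_apply, dif_pos (by norm_num)]
      have h1 : t = 0 := by ext; exact h0
      simp [h1]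
    · rw [Path.trans_apply, dif_neg (by
        change ¬ (t : ℝ) * (1 - 1 / 2) + 1 / 2 ≤ 1 / 2
        have : (0 : ℝ) < t := lt_of_le_of_ne ht.1 (Ne.symm h0)
        linarith)]
      congr 1
      ext
      change 2 * ((t : ℝ) * (1 - 1 / 2) + 1 / 2) - 1 = t
      ring
  have k3 : pathChain (segPath F (0, 0) (1, 0)) = pathChain (f.trans g) :=
    pathChain_congr fun t => by simp [segPath, F, AffineMap.lineMap_apply]
  rw [k1, k2, k3] at h
  have h3 := (boundaries X).neg_mem h
  convert h3 using 1
  abel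

theorem pathChain_sub_mem_of_homotopic {x y : X} {f g : Path x y} (h : f.Homotopic g) :
    pathChain f - pathChain g ∈ boundaries X := by
  obtain ⟨F⟩ := h
  have h := square_mem_boundaries F.toContinuousMap f (Path.refl y) (Path.refl x) g
    (fun t => F.apply_zero t) (fun t => F.target t) (fun t => F.source t) (fun t => F.apply_one t)
  have h1 := (boundaries X).sub_mem h
    ((boundaries X).sub_mem (pathChain_refl_mem y) (pathChain_refl_mem x))
  convert h1 using 1
  abel

/-- The two lateral sides of the square are the same path, the track `c` of the base point, and
cancel. -/
theorem pathChain_sub_mem_of_freelyHomotopic {x y : X} {f : Path x x} {g : Path y y}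
    (h : FreelyHomotopic f g) : pathChain f - pathChain g ∈ boundaries X := by
  obtain ⟨F, h0, h1, h2⟩ := h
  let c : Path x y := ⟨⟨fun u => F (u, 0), by fun_prop⟩, by simp [h0], by simp [h1]⟩
  have h := square_mem_boundaries F f c c g h0 (fun t => (h2 t).symm) (fun t => rfl) h1
  convert h using 1
  abel

theorem homologyπ_eq_of_sub_mem {y z : (singChains X).cycles 1}
    (h : (singChains X).iCycles 1 y - (singChains X).iCycles 1 z ∈ boundaries X) :
    (singChains X).homologyπ 1 y = (singChains X).homologyπ 1 z := by
  rw [← sub_eq_zero, ← map_sub]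
  apply homologyπ_eq_zero
  rwa [map_sub]

theorem loopClass_eq_of_freelyHomotopic {x y : X} {f : Path x x} {g : Path y y}
    (h : FreelyHomotopic f g) : loopClass f = loopClass g := by
  refine homologyπ_eq_of_sub_mem (y := loopCycle f) (z := loopCycle g) ?_
  rw [iCycles_loopCycle, iCycles_loopCycle]
  exact pathChain_sub_mem_of_freelyHomotopic h

theorem loopClass_eq_of_homotopic {x : X} {f g : Path x x} (h : f.Homotopic g) :
    loopClass f = loopClass g := by
  refine homologyπ_eq_of_sub_mem (y := loopCycle f) (z := loopCycle g) ?_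
  rw [iCycles_loopCycle, iCycles_loopCycle]
  exact pathChain_sub_mem_of_homotopic h

theorem loopClass_refl (x : X) : loopClass (Path.refl x) = 0 := by
  refine homologyπ_eq_zero (y := loopCycle (Path.refl x)) ?_
  rw [iCycles_loopCycle]
  exact pathChain_refl_mem x

theorem loopClass_trans {x : X} (f g : Path x x) :
    loopClass (f.trans g) = loopClass f + loopClass g := by
  refine Eq.trans (homologyπ_eq_of_sub_mem (y := loopCycle (f.trans g))
    (z := loopCycle f + loopCycle g) ?_) (map_add ((singChains X).homologyπ 1).hom _ _)
  rw [map_add, iCycles_loopCycle, iCycles_loopCycle, iCycles_loopCycle]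
  exact pathChain_trans_mem f g

theorem loopClass_symm {x : X} (f : Path x x) : loopClass f.symm = - loopClass f := by
  have h := loopClass_trans f f.symm
  have h2 : (f.trans f.symm).Homotopic (Path.refl x) := ⟨(Path.Homotopy.reflTransSymm f).symm⟩
  rw [loopClass_eq_of_homotopic h2, loopClass_refl] at h
  exact (neg_eq_of_add_eq_zero_right h.symm).symm

/-- The homotopy class of a loop in the fundamental group. -/
abbrev loopElt {x : X} (f : Path x x) : FundamentalGroup X x :=
  FundamentalGroup.fromPath (Path.Homotopic.Quotient.mk f)

/-- The class of a loop lies in the span of classes of generators of the fundamental group. -/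
theorem loopClass_mem_span {m : ℕ} {x : X} {g : Fin m → Path x x}
    (hg : Subgroup.closure (Set.range fun i => loopElt (g i)) = ⊤) (f : Path x x) :
    loopClass f ∈ Submodule.span ℤ (Set.range fun i => loopClass (g i)) := by
  suffices ∀ a : FundamentalGroup X x, ∀ f : Path x x, loopElt f = a →
      loopClass f ∈ Submodule.span ℤ (Set.range fun i => loopClass (g i)) from this _ f rfl
  have hex : ∀ a : FundamentalGroup X x, ∃ f : Path x x, loopElt f = a := fun a =>
    Path.Homotopic.Quotient.mk_surjective a
  intro a
  have ha : a ∈ Subgroup.closure (Set.range fun i => loopElt (g i)) := hg ▸ Subgroup.mem_top a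
  induction ha using Subgroup.closure_induction with
  | mem a ha =>
    obtain ⟨i, rfl⟩ := ha
    intro f hf
    rw [loopClass_eq_of_homotopic (Path.Homotopic.Quotient.exact hf)]
    exact Submodule.subset_span ⟨i, rfl⟩
  | one =>
    intro f hf
    rw [loopClass_eq_of_homotopic (Path.Homotopic.Quotient.exact hf), loopClass_refl]
    exact zero_mem _
  | mul a b _ _ iha ihb =>
    intro f hf
    obtain ⟨fa, rfl⟩ := hex a
    obtain ⟨fb, rfl⟩ := hex b
    -- Multiplication in `FundamentalGroup` is concatenation in reverse order, which does not matter
    -- in `H₁`.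
    have : f.Homotopic (fb.trans fa) := Path.Homotopic.Quotient.exact hf
    rw [loopClass_eq_of_homotopic this, loopClass_trans]
    exact add_mem (ihb _ rfl) (iha _ rfl)
  | inv a _ iha =>
    intro f hf
    obtain ⟨fa, rfl⟩ := hex a
    have : f.Homotopic fa.symm := Path.Homotopic.Quotient.exact hf
    rw [loopClass_eq_of_homotopic this, loopClass_symm]
    exact neg_mem (iha _ rfl)

/-- Generators of the fundamental group generate the first homology group. -/
theorem span_loopClass_eq_top [PathConnectedSpace X] {m : ℕ} {x : X} {g : Fin m → Path x x}
    (hg : Subgroup.closure (Set.range fun i => loopElt (g i)) = ⊤) :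
    Submodule.span ℤ (Set.range fun i => loopClass (g i)) = ⊤ := by
  set L := Submodule.span ℤ (Set.range fun i => loopClass (g i)) with hL
  -- The cycles whose class lies in `L`, viewed inside the chains. The aim is that `W` contains
  -- every cycle.
  let W : Submodule ℤ ((singChains X).X 1) :=
    (L.comap ((singChains X).homologyπ 1).hom).map ((singChains X).iCycles 1).hom
  have hB : ∀ c ∈ boundaries X, c ∈ W := by
    rintro c ⟨w, rfl⟩
    refine ⟨(singChains X).toCycles 2 1 w, ?_, congrArg (fun g => g.hom w)
      ((singChains X).toCycles_i 2 1)⟩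
    change (singChains X).homologyπ 1 _ ∈ L
    rw [homologyπ_eq_zero]
    · exact zero_mem _
    · exact ⟨w, (congrArg (fun g => g.hom w) ((singChains X).toCycles_i 2 1)).symm⟩
  have hP : ∀ f : Path x x, pathChain f ∈ W := fun f =>
    ⟨loopCycle f, loopClass_mem_span hg f, iCycles_loopCycle f⟩
  let p : ∀ y : X, Path x y := fun y => PathConnectedSpace.somePath x y
  obtain ⟨φ, hφ⟩ := exists_chains_desc (n := 0) (X := X)
    (fun s => pathChain (p (TopCat.toSSetObj₀Equiv (X := TopCat.of X) s)))
  have hφ' : ∀ y, φ (pointChain y) = pathChain (p y) := fun y => by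
    rw [pointChain, hφ, Equiv.apply_symm_apply]
  let : Module ℤ ((singChains X).X 1 ⧸ W) := Submodule.Quotient.module W
  -- Every chain `c` is congruent to `φ (d c)` modulo `W`: a path `f` from `y` to `z`, closed up by
  -- the chosen paths from `x`, is a loop at `x`, so its chain is congruent to that of `p z` minus
  -- that of `p y`. For a cycle, `d c = 0` and hence `c ∈ W`.
  have key : W.mkQ = W.mkQ ∘ₗ φ ∘ₗ ((singChains X).d 1 0).hom := by
    apply chains_induction
    intro s
    obtain ⟨y, z, f, rfl⟩ := exists_pathSimplex s
    change W.mkQ (pathChain f) = W.mkQ (φ ((singChains X).d 1 0 (pathChain f)))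
    rw [d_pathChain, map_sub, hφ', hφ', Submodule.mkQ_apply, Submodule.mkQ_apply,
      Submodule.Quotient.eq]
    have h1 := hP (((p y).trans f).trans (p z).symm)
    have h2 := hB _ (pathChain_trans_mem ((p y).trans f) (p z).symm)
    have h3 := hB _ (pathChain_trans_mem (p y) f)
    have h4 := hB _ (pathChain_trans_mem (p z) (p z).symm)
    have h5 := hB _ (pathChain_sub_mem_of_homotopic
      (show ((p z).trans (p z).symm).Homotopic (Path.refl x) from
        ⟨(Path.Homotopy.reflTransSymm (p z)).symm⟩))
    have h6 := hB _ (pathChain_refl_mem x)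
    have := sub_mem (sub_mem (sub_mem (add_mem (sub_mem h1 h2) h4) h3) h5) h6
    convert this using 1
    abel
  rw [eq_top_iff]
  intro h _
  obtain ⟨y, rfl⟩ := homologyπ_surjective h
  have h1 := LinearMap.congr_fun key ((singChains X).iCycles 1 y)
  have h2 : (singChains X).iCycles 1 y - φ ((singChains X).d 1 0 ((singChains X).iCycles 1 y))
      ∈ W := by
    exact (Submodule.Quotient.eq W).1 h1
  rw [d_iCycles, map_zero, sub_zero] at h2
  obtain ⟨y', hy', e⟩ := h2
  obtain rfl : y' = y := iCycles_injective e
  exact hy'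

end Hurewicz
end CanonicalCycles
end

noncomputable section

namespace CanonicalCycles

open scoped unitInterval Simplicial

/-! ### Variation of the logarithm -/

section LogVariation

open Classical in
/-- The variation of the logarithm along a path in the punctured plane. -/
def logVar (f : I → ℂ) : ℂ :=
  if h : ∃ L : C(I, ℂ), ∀ t, Complex.exp (L t) = f t then h.choose 1 - h.choose 0 else 0

/-- Two continuous logarithms of the same function differ by a constant, by uniqueness of lifts
along the covering `exp`; the choice made in `logVar` is therefore immaterial. -/
theorem logVar_eq {f : I → ℂ} (L : C(I, ℂ)) (hL : ∀ t, Complex.exp (L t) = f t) :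
    logVar f = L 1 - L 0 := by
  have h : ∃ L : C(I, ℂ), ∀ t, Complex.exp (L t) = f t := ⟨L, hL⟩
  rw [logVar, dif_pos h]
  set M := h.choose
  have hM : ∀ t, Complex.exp (M t) = f t := h.choose_spec
  have key : (fun t => M t) = fun t => L t + (M 0 - L 0) := by
    refine Complex.isCoveringMap_exp.eq_of_comp_eq M.continuous (by fun_prop) ?_ 0 (by simp)
    funext t
    apply Subtype.ext
    simp only [Function.comp]
    rw [hM, Complex.exp_add, hL, Complex.exp_sub, hM, hL, div_self, mul_one]
    rw [← hL]
    exact Complex.exp_ne_zero _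
  have := congrFun key 1
  linear_combination this

/-- Path lifting along `exp` onto the punctured plane. In particular the default value in `logVar`
does not occur for continuous functions without zeros. -/
theorem exists_log_path (f : C(I, ℂ)) (hf : ∀ t, f t ≠ 0) :
    ∃ L : C(I, ℂ), ∀ t, Complex.exp (L t) = f t := by
  let f' : C(I, {z : ℂ // z ≠ 0}) := ⟨fun t => ⟨f t, hf t⟩, by fun_prop⟩
  have h0 : f' 0 = ⟨Complex.exp (Complex.log (f 0)), Complex.exp_ne_zero _⟩ :=
    Subtype.ext (Complex.exp_log (hf 0)).symm
  refine ⟨Complex.isCoveringMap_exp.liftPath f' (Complex.log (f 0)) h0, fun t => ?_⟩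
  exact congrArg Subtype.val (congrFun (Complex.isCoveringMap_exp.liftPath_lifts f' _ h0) t)

theorem exists_log_square (f : C(I × I, ℂ)) (hf : ∀ t, f t ≠ 0) :
    ∃ L : C(I × I, ℂ), ∀ t, Complex.exp (L t) = f t := by
  let f' : C(I × I, {z : ℂ // z ≠ 0}) := ⟨fun t => ⟨f t, hf t⟩, by fun_prop⟩
  obtain ⟨L₀, hL₀⟩ := exists_log_path ⟨fun t => f (0, t), by fun_prop⟩ (fun t => hf (0, t))
  have h0 : ∀ a, f' (0, a) = ⟨Complex.exp (L₀ a), Complex.exp_ne_zero _⟩ :=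
    fun a => Subtype.ext (hL₀ a).symm
  refine ⟨Complex.isCoveringMap_exp.liftHomotopy f' L₀ h0, fun t => ?_⟩
  exact congrArg Subtype.val (congrFun (Complex.isCoveringMap_exp.liftHomotopy_lifts f' L₀ h0) t)

theorem logVar_const (z : ℂ) (hz : z ≠ 0) : logVar (fun _ => z) = 0 := by
  rw [logVar_eq (ContinuousMap.const _ (Complex.log z)) (fun _ => Complex.exp_log hz)]
  simp

/-- A logarithm exists on the whole triangle, pulled back to a square, and the variations along the
edges telescope. This is closedness of the winding cochain. -/
theorem logVar_triangle (v : C(stdSimplex ℝ (Fin 3), ℂ)) (hv : ∀ s, v s ≠ 0) :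
    logVar (simplexEdge v 1 2) - logVar (simplexEdge v 0 2) + logVar (simplexEdge v 0 1) = 0 := by
  -- The square is mapped to the triangle so that the side `{0} × I` collapses to vertex `0` and the
  -- other three sides become the edges `01`, `02`, `12`. On the collapsed side the logarithm has
  -- variation zero.
  let q : C(I × I, stdSimplex ℝ (Fin 3)) :=
    ⟨fun p => ⟨![1 - (p.1 : ℝ), p.1 * (1 - p.2), p.1 * p.2], by
      have h1 := p.1.2
      have h2 := p.2.2
      constructor
      · intro i
        fin_cases i
        · simpa using h1.2
        · exact mul_nonneg h1.1 (sub_nonneg.2 h2.2)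
        · exact mul_nonneg h1.1 h2.1
      · simp [Fin.sum_univ_three]
        ring⟩, by
      refine Continuous.subtype_mk (continuous_pi fun i => ?_) _
      fin_cases i <;> simp <;> fun_prop⟩
  obtain ⟨L, hL⟩ := exists_log_square (v.comp q) (fun _ => hv _)
  have coord : ∀ (i j : Fin 3) (t : I) (k : Fin 3),
      (stdSimplex.map ![i, j] (stdSimplexHomeomorphUnitInterval.symm t)) k =
        (if i = k then 1 - (t : ℝ) else 0) + (if j = k then (t : ℝ) else 0) := by
    intro i j t k
    simp [FunOnFinite.linearMap_apply_apply, Finset.sum_filter, Fin.sum_univ_two]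
    rfl
  have e01 : ∀ t, simplexEdge v 0 1 t = v (q (t, 0)) := fun t => by
    refine congrArg v (stdSimplex.ext (funext fun k => (coord _ _ _ _).trans ?_))
    fin_cases k <;> simp [q] <;> rfl
  have e02 : ∀ t, simplexEdge v 0 2 t = v (q (t, 1)) := fun t => by
    refine congrArg v (stdSimplex.ext (funext fun k => (coord _ _ _ _).trans ?_))
    fin_cases k <;> simp [q] <;> rfl
  have e12 : ∀ t, simplexEdge v 1 2 t = v (q (1, t)) := fun t => by
    refine congrArg v (stdSimplex.ext (funext fun k => (coord _ _ _ _).trans ?_))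
    fin_cases k <;> simp [q] <;> rfl
  have e00 : ∀ t : I, v (q (0, t)) = v (q (0, 0)) := fun t => by
    refine congrArg v (stdSimplex.ext (funext fun k => ?_))
    fin_cases k <;> simp [q]
  rw [logVar_eq ⟨fun t => L (1, t), by fun_prop⟩ (fun t => (hL _).trans (e12 t).symm),
    logVar_eq ⟨fun t => L (t, 1), by fun_prop⟩ (fun t => (hL _).trans (e02 t).symm),
    logVar_eq ⟨fun t => L (t, 0), by fun_prop⟩ (fun t => (hL _).trans (e01 t).symm)]
  have h0 := logVar_eq ⟨fun t => L (0, t), by fun_prop⟩ (fun t => (hL _).trans (e00 t))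
  rw [logVar_const _ (hv _)] at h0
  simp only [ContinuousMap.coe_mk] at h0 ⊢
  linear_combination -h0

end LogVariation

/-! ### Detection of a basis of `H₁` by winding numbers -/

section Criterion

variable {X : Type} [TopologicalSpace X]

/-- A nowhere vanishing function defines a linear form on the first homology group. -/
theorem exists_logVar_functional (u : C(X, ℂ)) (hu : ∀ x, u x ≠ 0) :
    ∃ Φ : H1 X →ₗ[ℤ] ℂ, ∀ {x : X} (f : Path x x), Φ (loopClass f) = logVar (fun t => u (f t)) := by
  obtain ⟨φ, hφ⟩ := exists_chains_desc (n := 1) (X := X) (M := ℂ)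
    (fun s => logVar fun t => u ((TopCat.of X).toSSetObjEquiv _ s
      (stdSimplexHomeomorphUnitInterval.symm t)))
  have hφ' : ∀ {x y : X} (f : Path x y), φ (pathChain f) = logVar (fun t => u (f t)) := by
    intro x y f
    rw [pathChain, hφ, pathSimplex_eq]
    simp
  have hd : φ ∘ₗ ((singChains X).d 2 1).hom = 0 := by
    apply chains_induction
    intro s
    obtain ⟨g, rfl⟩ := exists_triangle s
    change φ ((singChains X).d 2 1 _) = 0
    rw [d_triangle, map_add, map_sub, hφ', hφ', hφ']
    exact logVar_triangle (u.comp g) (fun _ => hu _)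
  obtain ⟨Φ, hΦ⟩ := exists_H1_desc φ (fun w => LinearMap.congr_fun hd w)
  refine ⟨Φ, fun f => ?_⟩
  rw [← homologyπ_loopCycle, hΦ, iCycles_loopCycle, hφ']

/-- Loops which generate the fundamental group and are separated by the variations of the
logarithms of nowhere vanishing functions are not contractible and give a basis of `H₁`. -/
theorem cycles_of_generate [PathConnectedSpace X] {m : ℕ} {y : Fin m → X}
    {l : ∀ i, Path (y i) (y i)} {x : X} {g : Fin m → Path x x}
    (hgl : ∀ i, FreelyHomotopic (g i) (l i))
    (hg : Subgroup.closure (Set.range fun i => loopElt (g i)) = ⊤)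
    (u : Fin m → C(X, ℂ)) (hu : ∀ j z, u j z ≠ 0)
    (hw : ∀ i j, logVar (fun t => u j (l i t)) = if i = j then 2 * Real.pi * Complex.I else 0) :
    (∀ i z, ¬ FreelyHomotopic (l i) (Path.refl z)) ∧
      ∃ b : Module.Basis (Fin m) ℤ (H1 X), ∀ i, b i = loopClass (l i) := by
  choose Φ hΦ using fun j => exists_logVar_functional (u j) (hu j)
  have hpi : (2 * Real.pi * Complex.I : ℂ) ≠ 0 := Complex.two_pi_I_ne_zero
  constructor
  · intro i z h
    have h1 := congrArg (Φ i) (loopClass_eq_of_freelyHomotopic h)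
    rw [hΦ, hw, if_pos rfl, loopClass_refl, map_zero] at h1
    exact hpi h1
  · have hsp := span_loopClass_eq_top hg
    simp only [fun i => loopClass_eq_of_freelyHomotopic (hgl i)] at hsp
    -- The matrix of the forms `Φ j` on the loop classes is `2πi` times the identity, so `Φ j`
    -- isolates the `j`-th coefficient of a relation.
    have hli : LinearIndependent ℤ fun i => loopClass (l i) := by
      rw [Fintype.linearIndependent_iff]
      intro c hc j
      have h1 := congrArg (Φ j) hc
      rw [map_sum, map_zero] at h1
      simp only [map_smul, hΦ, hw] at h1
      simpa [hpi] using h1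
    exact ⟨Module.Basis.mk hli hsp.ge, fun i => by simp⟩

end Criterion
end CanonicalCycles
end

noncomputable section

namespace CanonicalCycles

open scoped unitInterval Simplicial

/-! ### Free homotopy and change of base point -/

section FreeHomotopy

variable {X : Type} [TopologicalSpace X]

theorem freelyHomotopic_iff {x y : X} {f : Path x x} {g : Path y y} :
    FreelyHomotopic f g ↔
      f.toContinuousMap.HomotopicWith g.toContinuousMap (fun h => h 0 = h 1) := by
  constructor
  · rintro ⟨F, h0, h1, h2⟩
    exact ⟨{ toContinuousMap := F, map_zero_left := h0, map_one_left := h1, prop' := h2 }⟩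
  · rintro ⟨F⟩
    exact ⟨F.toContinuousMap, F.map_zero_left, F.map_one_left, F.prop'⟩

theorem FreelyHomotopic.trans {x y z : X} {f : Path x x} {g : Path y y} {k : Path z z}
    (h : FreelyHomotopic f g) (h' : FreelyHomotopic g k) : FreelyHomotopic f k :=
  freelyHomotopic_iff.2 ((freelyHomotopic_iff.1 h).trans (freelyHomotopic_iff.1 h'))

theorem FreelyHomotopic.of_eq {x y : X} {f : Path x x} {g : Path y y} (h : ∀ t, f t = g t) :
    FreelyHomotopic f g :=
  ⟨⟨fun p => f p.2, by fun_prop⟩, fun _ => rfl, h, fun _ => by simp⟩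

theorem FreelyHomotopic.map {Y : Type} [TopologicalSpace Y] {x y : X} {f : Path x x}
    {g : Path y y} (h : FreelyHomotopic f g) (e : C(X, Y)) :
    FreelyHomotopic (f.map e.continuous) (g.map e.continuous) := by
  obtain ⟨F, h0, h1, h2⟩ := h
  exact ⟨e.comp F, fun s => congrArg e (h0 s), fun s => congrArg e (h1 s),
    fun s => congrArg e (h2 s)⟩

/-- Conjugation by a path does not change the free homotopy class of a loop. -/
theorem freelyHomotopic_conj {x y : X} (p : Path x y) (g : Path x x) :
    FreelyHomotopic (p.symm.trans (g.trans p)) g := by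
  let e := p.symm.trans (g.trans p)
  have he1 : ∀ t : ℝ, t ∈ I → t ≤ 1 / 2 → e.extend t = p.extend (1 - 2 * t) := by
    intro t ht h
    rw [Path.extend_apply e ht, Path.trans_apply, dif_pos h]
    exact (Path.extend_apply p (t := 1 - 2 * t) ⟨by linarith [ht.1], by linarith [ht.1]⟩).symm
  have he2 : ∀ t : ℝ, t ∈ I → 1 / 2 ≤ t → t ≤ 3 / 4 → e.extend t = g.extend (4 * t - 2) := by
    intro t ht h h'
    rcases h.eq_or_lt with rfl | h
    · rw [he1 _ ht le_rfl]
      norm_num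
    rw [Path.extend_apply e ht, Path.trans_apply, dif_neg (not_le.2 h), Path.trans_apply,
      dif_pos (show 2 * t - 1 ≤ 1 / 2 by linarith), ← Path.extend_apply]
    congr 1
    ring
  have he3 : ∀ t : ℝ, t ∈ I → 3 / 4 ≤ t → e.extend t = p.extend (4 * t - 3) := by
    intro t ht h'
    rcases h'.eq_or_lt with rfl | h
    · rw [he2 _ ht (by norm_num) le_rfl]
      norm_num
    rw [Path.extend_apply e ht, Path.trans_apply, dif_neg (by
      change ¬ t ≤ 1 / 2; linarith), Path.trans_apply,
      dif_neg (show ¬ 2 * t - 1 ≤ 1 / 2 by linarith), ← Path.extend_apply]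
    congr 1
    ring
  -- At time `u` the loop is `e` restricted to `[u / 2, 1 - u / 4]`. Both ends lie at `p (1 - u)`,
  -- so every stage is closed, and at `u = 1` exactly the stretch `[1 / 2, 3 / 4]` remains, on which
  -- `e` runs through `g`.
  refine ⟨⟨fun v => e.extend ((1 - v.2) * (v.1 / 2) + v.2 * (1 - v.1 / 4)), by fun_prop⟩,
    ?_, ?_, ?_⟩
  · intro s
    simp [e]
  · intro s
    have hs := s.2
    have := he2 ((1 - s) * (1 / 2) + s * (1 - 1 / 4))
      ⟨by linarith [hs.1, hs.2], by linarith [hs.1, hs.2]⟩ (by linarith [hs.1])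
      (by linarith [hs.2])
    simp only [ContinuousMap.coe_mk, Set.Icc.coe_one]
    rw [this]
    ring_nf
    simp
  · intro u
    have hu := u.2
    have h1 := he1 (u / 2) ⟨by linarith [hu.1], by linarith [hu.2]⟩ (by linarith [hu.2])
    have h2 := he3 (1 - u / 4) ⟨by linarith [hu.2], by linarith [hu.1]⟩ (by linarith [hu.2])
    simp only [ContinuousMap.coe_mk, Set.Icc.coe_one, Set.Icc.coe_zero]
    ring_nf at h1 h2 ⊢
    rw [h1, h2]

/-- Loops which generate the fundamental group at one base point can be moved to any other. -/
theorem exists_generate_at [PathConnectedSpace X] {ι : Type} {x : X} (g : ι → Path x x)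
    {s : Set ι} (hg : Subgroup.closure ((fun i => loopElt (g i)) '' s) = ⊤) (z : X) :
    ∃ g' : ι → Path z z, (∀ i, FreelyHomotopic (g' i) (g i)) ∧
      Subgroup.closure ((fun i => loopElt (g' i)) '' s) = ⊤ := by
  let p : Path x z := PathConnectedSpace.somePath x z
  refine ⟨fun i => p.symm.trans ((g i).trans p), fun i => freelyHomotopic_conj p (g i), ?_⟩
  let e := FundamentalGroup.fundamentalGroupMulEquivOfPath p
  have he : ∀ i, loopElt (p.symm.trans ((g i).trans p)) = e (loopElt (g i)) := fun i => rfl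
  simp only [he]
  rw [show ((fun i => e (loopElt (g i))) '' s) =
    e.toMonoidHom '' ((fun i => loopElt (g i)) '' s) from by
      rw [← Set.image_comp]; rfl, ← MonoidHom.map_closure, hg, ← MonoidHom.range_eq_map]
  exact MonoidHom.range_eq_top.2 e.surjective

end FreeHomotopy

/-! ### The generation half of van Kampen's theorem -/

section VanKampen

variable {T : Type} [TopologicalSpace T]

theorem loopElt_trans {X : Type} [TopologicalSpace X] {x : X} (f g : Path x x) :
    loopElt (f.trans g) = loopElt g * loopElt f := rfl

theorem loopElt_eq {X : Type} [TopologicalSpace X] {x : X} {f g : Path x x} (h : f.Homotopic g) :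
    loopElt f = loopElt g := congrArg FundamentalGroup.fromPath (Path.Homotopic.Quotient.eq.2 h)

/-- Inserting `q` and its inverse at the breaking point changes nothing in the fundamental groupoid.
-/
theorem loopElt_conj_trans {X : Type} [TopologicalSpace X] {x y z w : X} (p : Path x y)
    (q : Path x z) (r : Path x w) (f : Path y z) (g : Path z w) :
    loopElt ((p.trans (f.trans g)).trans r.symm) =
      loopElt ((q.trans g).trans r.symm) * loopElt ((p.trans f).trans q.symm) := by
  let e : ∀ {a b : X}, Path a b → (FundamentalGroupoid.mk a ⟶ FundamentalGroupoid.mk b) :=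
    fun f => FundamentalGroupoid.fromPath (Path.Homotopic.Quotient.mk f)
  have h : ((e p ≫ e f) ≫ inv (e q)) ≫ ((e q ≫ e g) ≫ inv (e r)) =
    (e p ≫ (e f ≫ e g)) ≫ inv (e r) := by simp
  simp only [← Groupoid.inv_eq_inv] at h
  exact h.symm

/-- A subgroup of the fundamental group of a union of two open sets with path connected
intersection is everything if it contains the loops in each of the two sets. -/
theorem eq_top_of_union {S S₁ S₂ : Set T} (hS : S₁ ∪ S₂ = S) (ho₁ : IsOpen S₁) (ho₂ : IsOpen S₂)
    (hp₁ : IsPathConnected S₁) (hp₂ : IsPathConnected S₂) (hp : IsPathConnected (S₁ ∩ S₂))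
    (x : S) (hx : (x : T) ∈ S₁ ∩ S₂) (K : Subgroup (FundamentalGroup S x))
    (h₁ : ∀ f : Path x x, (∀ t, (f t : T) ∈ S₁) → loopElt f ∈ K)
    (h₂ : ∀ f : Path x x, (∀ t, (f t : T) ∈ S₂) → loopElt f ∈ K) : K = ⊤ := by
  have lift : ∀ (A : Set T), A ⊆ S → ∀ y : S, JoinedIn A (x : T) y →
      ∃ p : Path x y, ∀ t, (p t : T) ∈ A := by
    intro A hA y hj
    refine ⟨⟨⟨fun t => ⟨hj.somePath t, hA (hj.somePath_mem t)⟩, by fun_prop⟩, ?_, ?_⟩,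
      hj.somePath_mem⟩
    · exact Subtype.ext hj.somePath.source
    · exact Subtype.ext hj.somePath.target
  have hS₁ : S₁ ⊆ S := hS ▸ Set.subset_union_left
  have hS₂ : S₂ ⊆ S := hS ▸ Set.subset_union_right
  -- The path to `y` stays in each of the two sets that contains `y`; for `y` in both, this uses
  -- path connectedness of the intersection.
  have hp' : ∀ y : S, ∃ p : Path x y, ((y : T) ∈ S₁ → ∀ t, (p t : T) ∈ S₁) ∧
      ((y : T) ∈ S₂ → ∀ t, (p t : T) ∈ S₂) := by
    intro y
    by_cases y1 : (y : T) ∈ S₁ <;> by_cases y2 : (y : T) ∈ S₂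
    · obtain ⟨p, hp⟩ := lift _ (Set.inter_subset_left.trans hS₁) y (hp.joinedIn _ hx _ ⟨y1, y2⟩)
      exact ⟨p, fun _ t => (hp t).1, fun _ t => (hp t).2⟩
    · obtain ⟨p, hp⟩ := lift _ hS₁ y (hp₁.joinedIn _ hx.1 _ y1)
      exact ⟨p, fun _ t => hp t, fun h => absurd h y2⟩
    · obtain ⟨p, hp⟩ := lift _ hS₂ y (hp₂.joinedIn _ hx.2 _ y2)
      exact ⟨p, fun h => absurd h y1, fun _ t => hp t⟩
    · exact absurd (hS.symm ▸ y.2 : (y : T) ∈ S₁ ∪ S₂) (by simp [y1, y2])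
  choose p hpA hpB using hp'
  -- `Q` extends membership in `K` from loops at `x` to all paths, by closing them up with the
  -- chosen paths. It passes to concatenations and holds for paths inside one of the two sets, so a
  -- sufficiently fine subdivision of a loop gives the result.
  let Q : ∀ {y z : S}, Path y z → Prop := fun {y z} h =>
    loopElt (((p y).trans h).trans (p z).symm) ∈ K
  have trans_mem : ∀ {y z w : S} (A : Set T) (f : Path y z) (g : Path z w),
      (∀ t, (f t : T) ∈ A) → (∀ t, (g t : T) ∈ A) → ∀ t, (f.trans g t : T) ∈ A := by
    intro y z w A f g hf hg t
    rw [Path.trans_apply]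
    split_ifs
    · exact hf _
    · exact hg _
  have Q₁ : ∀ {y z : S} (f : Path y z), (∀ t, (f t : T) ∈ S₁) → Q f := by
    intro y z f hf
    refine h₁ _ (trans_mem _ _ _ (trans_mem _ _ _ (hpA y ?_) hf) fun t => hpA z ?_ _)
    · simpa using hf 0
    · simpa using hf 1
  have Q₂ : ∀ {y z : S} (f : Path y z), (∀ t, (f t : T) ∈ S₂) → Q f := by
    intro y z f hf
    refine h₂ _ (trans_mem _ _ _ (trans_mem _ _ _ (hpB y ?_) hf) fun t => hpB z ?_ _)
    · simpa using hf 0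
    · simpa using hf 1
  have Qt : ∀ {y z w : S} (f : Path y z) (g : Path z w), Q f → Q g → Q (f.trans g) := by
    intro y z w f g hf hg
    change loopElt _ ∈ K
    rw [loopElt_conj_trans (p y) (p z) (p w) f g]
    exact K.mul_mem hg hf
  have Qh : ∀ {y z : S} {f g : Path y z}, f.Homotopic g → Q f → Q g := by
    intro y z f g h hf
    have : loopElt (((p y).trans f).trans (p z).symm) = loopElt (((p y).trans g).trans (p z).symm) :=
      loopElt_eq (((Path.Homotopic.refl _).hcomp h).hcomp (Path.Homotopic.refl _))
    change loopElt _ ∈ K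
    rw [← this]
    exact hf
  rw [eq_top_iff]
  rintro a -
  obtain ⟨f, rfl⟩ : ∃ f, loopElt f = a := Path.Homotopic.Quotient.mk_surjective a
  let c : Bool → Set I := fun b => {t | (f t : T) ∈ cond b S₁ S₂}
  obtain ⟨t, t0, tmono, ⟨N, hN⟩, ht⟩ := exists_monotone_Icc_subset_open_cover_unitInterval (c := c)
    (by
      rintro (_ | _)
      · exact ho₂.preimage (by fun_prop : Continuous fun t => (f t : T))
      · exact ho₁.preimage (by fun_prop : Continuous fun t => (f t : T)))
    (by
      intro s _
      have : (f s : T) ∈ S₁ ∪ S₂ := hS ▸ (f s).2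
      rcases this with h | h
      · exact Set.mem_iUnion.2 ⟨true, h⟩
      · exact Set.mem_iUnion.2 ⟨false, h⟩)
  have hstep : ∀ n, Q (f.subpath (t n) (t (n + 1))) := by
    intro n
    obtain ⟨b, hb⟩ := ht n
    have hr : ∀ s, ∃ r ∈ Set.Icc (t n) (t (n + 1)), f r = f.subpath (t n) (t (n + 1)) s := by
      intro s
      have : f.subpath (t n) (t (n + 1)) s ∈ Set.range (f.subpath (t n) (t (n + 1))) := ⟨s, rfl⟩
      rwa [Path.range_subpath_of_le _ _ _ (tmono n.le_succ)] at this
    cases b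
    · refine Q₂ _ fun s => ?_
      obtain ⟨r, hr, e⟩ := hr s
      rw [← e]
      exact hb hr
    · refine Q₁ _ fun s => ?_
      obtain ⟨r, hr, e⟩ := hr s
      rw [← e]
      exact hb hr
  have hall : ∀ n, Q (f.subpath (t 0) (t n)) := by
    intro n
    induction n with
    | zero =>
      rw [Path.subpath_self]
      rcases (show (f (t 0) : T) ∈ S₁ ∪ S₂ from hS ▸ (f (t 0)).2) with h | h
      · exact Q₁ _ fun _ => h
      · exact Q₂ _ fun _ => h
    | succ n ih =>
      exact Qh ⟨Path.Homotopy.subpathTransSubpath f (t 0) (t n) (t (n + 1))⟩ (Qt _ _ ih (hstep n))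
  have hfin := hall N
  rw [t0, hN N le_rfl, Path.subpath_zero_one] at hfin
  have hf : Q f := by
    have : ∀ {y z : S} (hy : y = x) (hz : z = x), Q (f.cast hy hz) → Q f := by
      rintro y z rfl rfl h
      exact h
    exact this _ _ hfin
  -- The chosen path from `x` to itself need not be constant, but it is a loop in `S₁`, so
  -- conjugation by its class can be undone inside `K`.
  have hpx : loopElt (p x) ∈ K := h₁ _ (hpA x hx.1)
  have hconj : loopElt (((p x).trans f).trans (p x).symm) =
      (loopElt (p x))⁻¹ * (loopElt f * loopElt (p x)) := rfl
  have hf' : (loopElt (p x))⁻¹ * (loopElt f * loopElt (p x)) ∈ K := hconj ▸ hf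
  have := K.mul_mem (K.mul_mem hpx hf') (K.inv_mem hpx)
  have e : ∀ {G : Type} [Group G] (a b : G), a * (a⁻¹ * (b * a)) * a⁻¹ = b := by
    intro G _ a b
    group
  rwa [e] at this

end VanKampen
end CanonicalCycles
end

noncomputable section

namespace CanonicalCycles

open scoped unitInterval Simplicial

/-! ### Circles and their powers -/

section Circles

theorem add_mem_of_norm_le {S : Set ℂ} {b : ℂ} {r : ℝ} (h : Metric.closedBall b r \ {b} ⊆ S)
    {w : ℂ} (h0 : w ≠ 0) (hw : ‖w‖ ≤ r) : b + w ∈ S :=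
  h ⟨by simpa using hw, by simpa using h0⟩

theorem norm_ofReal_mul_exp (r θ : ℝ) : ‖(r : ℂ) * Complex.exp (2 * Real.pi * Complex.I * θ)‖ = |r| := by
  have : (2 * Real.pi * Complex.I * θ : ℂ) = ((2 * Real.pi * θ : ℝ) : ℂ) * Complex.I := by
    push_cast
    ring
  rw [norm_mul, this, Complex.norm_exp_ofReal_mul_I, mul_one, Complex.norm_real, Real.norm_eq_abs]

theorem add_mul_exp_mem {S : Set ℂ} {b : ℂ} {r : ℝ} (h : Metric.closedBall b r \ {b} ⊆ S)
    {t : ℝ} (h0 : 0 < t) (ht : t ≤ r) (θ : ℝ) :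
    b + t * Complex.exp (2 * Real.pi * Complex.I * θ) ∈ S :=
  add_mem_of_norm_le h (mul_ne_zero (by exact_mod_cast h0.ne') (Complex.exp_ne_zero _))
    (by rwa [norm_ofReal_mul_exp, abs_of_pos h0])

theorem add_ofReal_mem {S : Set ℂ} {b : ℂ} {r : ℝ} (hr : 0 < r)
    (h : Metric.closedBall b r \ {b} ⊆ S) : b + r ∈ S := by
  simpa using add_mul_exp_mem h hr le_rfl 0

/-- The circle of centre `b` and radius `r`, as a loop in `S`. -/
def circlePath {S : Set ℂ} {b : ℂ} {r : ℝ} (hr : 0 < r) (h : Metric.closedBall b r \ {b} ⊆ S) :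
    Path (⟨b + r, add_ofReal_mem hr h⟩ : S) ⟨b + r, add_ofReal_mem hr h⟩ where
  toFun s := ⟨b + r * Complex.exp (2 * Real.pi * Complex.I * (s : ℝ)),
    add_mul_exp_mem h hr le_rfl s⟩
  continuous_toFun := by fun_prop
  source' := by simp
  target' := by simp

/-- Interpolating the radii stays inside the larger of the two punctured discs, which is contained
in `S`. -/
theorem circlePath_freelyHomotopic {S : Set ℂ} {b : ℂ} {r r' : ℝ} (hr : 0 < r) (hr' : 0 < r')
    (h : Metric.closedBall b r \ {b} ⊆ S) (h' : Metric.closedBall b r' \ {b} ⊆ S) :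
    FreelyHomotopic (circlePath hr h) (circlePath hr' h') := by
  have hm : Metric.closedBall b (max r r') \ {b} ⊆ S := by
    rcases max_choice r r' with e | e <;> rw [e] <;> assumption
  have hpos : ∀ u : I, 0 < (1 - (u : ℝ)) * r + u * r' := fun u => by
    rcases u.2.1.eq_or_lt with e | e
    · rw [← e]
      simpa using hr
    · have := mul_nonneg (sub_nonneg.2 u.2.2) hr.le
      have := mul_pos e hr'
      linarith
  have hle : ∀ u : I, (1 - (u : ℝ)) * r + u * r' ≤ max r r' := fun u => by
    have h1 := mul_le_mul_of_nonneg_left (le_max_left r r') (sub_nonneg.2 u.2.2)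
    have h2 := mul_le_mul_of_nonneg_left (le_max_right r r') u.2.1
    linarith
  refine ⟨⟨fun v => ⟨b + (((1 - (v.1 : ℝ)) * r + v.1 * r' : ℝ) : ℂ) *
    Complex.exp (2 * Real.pi * Complex.I * (v.2 : ℝ)), add_mul_exp_mem hm (hpos _) (hle _) _⟩,
    by fun_prop⟩, ?_, ?_, ?_⟩
  · intro s
    apply Subtype.ext
    simp [circlePath]
  · intro s
    apply Subtype.ext
    simp [circlePath]
  · intro u
    apply Subtype.ext
    simp

theorem homotopic_of_map {S : Set ℂ} {x y : S} {f g : Path x y} (H : I × I → ℂ) (hH : Continuous H)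
    (hS : ∀ v, H v ∈ S) (h0 : ∀ t, H (0, t) = f t) (h1 : ∀ t, H (1, t) = g t)
    (hx : ∀ u, H (u, 0) = x) (hy : ∀ u, H (u, 1) = y) : f.Homotopic g :=
  ⟨{ toFun := fun v => ⟨H v, hS v⟩
     continuous_toFun := by fun_prop
     map_zero_left := fun t => Subtype.ext (h0 t)
     map_one_left := fun t => Subtype.ext (h1 t)
     prop' := by
      rintro u t (rfl | rfl)
      · exact Subtype.ext ((hx u).trans (by simp))
      · exact Subtype.ext ((hy u).trans (by simp)) }⟩

theorem exp_two_pi_mul_int (n : ℤ) :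
    Complex.exp (2 * Real.pi * Complex.I * ((n : ℝ) : ℂ)) = 1 := by
  rw [Complex.exp_eq_one_iff]
  exact ⟨n, by push_cast; ring⟩

/-- The loop which runs on a circle with angle `2πθ`. -/
def turnPath {S : Set ℂ} {b : ℂ} {r : ℝ} (hr : 0 < r) (h : Metric.closedBall b r \ {b} ⊆ S)
    (θ : C(I, ℝ)) (h0 : θ 0 = 0) (n : ℤ) (h1 : θ 1 = n) :
    Path (⟨b + r, add_ofReal_mem hr h⟩ : S) ⟨b + r, add_ofReal_mem hr h⟩ where
  toFun s := ⟨b + r * Complex.exp (2 * Real.pi * Complex.I * (θ s : ℝ)),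
    add_mul_exp_mem h hr le_rfl _⟩
  continuous_toFun := by fun_prop
  source' := by simp [h0]
  target' := by
    apply Subtype.ext
    simp only [h1, exp_two_pi_mul_int, mul_one]

/-- The angle functions are interpolated linearly; since their end values agree, the base point does
not move. Only the total number of turns matters. -/
theorem turnPath_homotopic {S : Set ℂ} {b : ℂ} {r : ℝ} (hr : 0 < r)
    (h : Metric.closedBall b r \ {b} ⊆ S) (θ θ' : C(I, ℝ)) (h0 : θ 0 = 0) (h0' : θ' 0 = 0) (n : ℤ)
    (h1 : θ 1 = n) (h1' : θ' 1 = n) :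
    (turnPath hr h θ h0 n h1).Homotopic (turnPath hr h θ' h0' n h1') := by
  refine homotopic_of_map (fun v => b + r * Complex.exp (2 * Real.pi * Complex.I *
    (((1 - (v.1 : ℝ)) * θ v.2 + v.1 * θ' v.2 : ℝ) : ℂ))) (by fun_prop)
    (fun v => add_mul_exp_mem h hr le_rfl _) ?_ ?_ ?_ ?_
  · intro t
    simp [turnPath]
  · intro t
    simp [turnPath]
  · intro u
    simp [h0, h0']
  · intro u
    have : (1 - (u : ℝ)) * θ 1 + u * θ' 1 = n := by rw [h1, h1']; ring
    simp only [this, exp_two_pi_mul_int, mul_one]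

/-- The circle run through `n` times. -/
def powPath {S : Set ℂ} {b : ℂ} {r : ℝ} (hr : 0 < r) (h : Metric.closedBall b r \ {b} ⊆ S)
    (n : ℤ) : Path (⟨b + r, add_ofReal_mem hr h⟩ : S) ⟨b + r, add_ofReal_mem hr h⟩ :=
  turnPath hr h ⟨fun t => n * t, by fun_prop⟩ (by simp) n (by simp)

theorem loopElt_powPath_add_one {S : Set ℂ} {b : ℂ} {r : ℝ} (hr : 0 < r)
    (h : Metric.closedBall b r \ {b} ⊆ S) (n : ℤ) :
    loopElt (powPath hr h (n + 1)) = loopElt (circlePath hr h) * loopElt (powPath hr h n) := by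
  rw [← loopElt_trans]
  -- Angles are concatenated instead of points: `n` turns followed by one turn have the angle
  -- function `p.trans q` up to full turns on the second half.
  let p : Path (0 : ℝ) n := ⟨⟨fun t => n * t, by fun_prop⟩, by simp, by simp⟩
  let q : Path (n : ℝ) ((n + 1 : ℤ) : ℝ) :=
    ⟨⟨fun t => n + t, by fun_prop⟩, by simp, by simp⟩
  have e : (powPath hr h n).trans (circlePath hr h) =
      turnPath hr h (p.trans q).toContinuousMap (p.trans q).source (n + 1) (p.trans q).target := by
    ext t
    change _ = b + r * Complex.exp (2 * Real.pi * Complex.I * ((p.trans q t : ℝ) : ℂ))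
    rw [Path.trans_apply, Path.trans_apply]
    split_ifs with ht
    · rfl
    · change b + r * Complex.exp (2 * Real.pi * Complex.I * ((2 * (t : ℝ) - 1 : ℝ) : ℂ)) =
        b + r * Complex.exp (2 * Real.pi * Complex.I * (((n : ℝ) + (2 * (t : ℝ) - 1) : ℝ) : ℂ))
      rw [Complex.ofReal_add, mul_add, Complex.exp_add, exp_two_pi_mul_int, one_mul]
  rw [e]
  exact loopElt_eq (turnPath_homotopic hr h _ _ _ _ _ _ _)

theorem loopElt_powPath_mem {S : Set ℂ} {b : ℂ} {r : ℝ} (hr : 0 < r)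
    (h : Metric.closedBall b r \ {b} ⊆ S) (n : ℤ) :
    loopElt (powPath hr h n) ∈ Subgroup.closure {loopElt (circlePath hr h)} := by
  have hc : loopElt (circlePath hr h) ∈ Subgroup.closure {loopElt (circlePath hr h)} :=
    Subgroup.subset_closure rfl
  induction n using Int.induction_on with
  | zero =>
    have : powPath hr h 0 = Path.refl _ := by
      ext t
      simp [powPath, turnPath]
    rw [this]
    exact one_mem _
  | succ i ih =>
    rw [loopElt_powPath_add_one]
    exact mul_mem hc ih
  | pred i ih =>
    have := loopElt_powPath_add_one hr h (-(i : ℤ) - 1)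
    rw [sub_add_cancel] at this
    rw [this] at ih
    exact (Subgroup.mul_mem_cancel_left _ hc).1 ih

end Circles

/-! ### Convex sets with one puncture -/

section Base

/-- Since `w` lies on the open ray from `b` through `z`, each point of the segment is `b` plus a
positive multiple of `z - b`. Radial moves therefore never meet `b`. -/
theorem mem_diff_of_segment {C : Set ℂ} (hC : Convex ℝ C) {b z : ℂ} (hz : z ∈ C) (hb : z ≠ b)
    {r : ℝ} (hrC : Metric.closedBall b r ⊆ C) {w : ℂ} {t : ℝ} (ht : 0 < t)
    (hw : w = b + t * (z - b)) (hwr : ‖w - b‖ = r) (u : I) :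
    AffineMap.lineMap z w (u : ℝ) ∈ C \ {b} := by
  constructor
  · refine hC.lineMap_mem hz (hrC ?_) u.2
    rw [Metric.mem_closedBall, dist_eq_norm, hwr]
  · have e : AffineMap.lineMap z w (u : ℝ) - b = (((1 - u) + u * t : ℝ) : ℂ) * (z - b) := by
      rw [hw, AffineMap.lineMap_apply_module]
      simp only [Complex.real_smul]
      push_cast
      ring
    have hpos : 0 < (1 - (u : ℝ)) + u * t := by
      rcases u.2.1.eq_or_lt with h | h
      · rw [← h]
        norm_num
      · have := mul_pos h ht
        have := u.2.2
        linarith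
    intro h
    rw [Set.mem_singleton_iff] at h
    rw [h, sub_self, eq_comm] at e
    rcases mul_eq_zero.1 e with h' | h'
    · exact hpos.ne' (by exact_mod_cast h')
    · exact hb (sub_eq_zero.1 h')

/-- Points move radially to a circle about `b`, which is path connected because the real dimension
exceeds one. -/
theorem isPathConnected_convex_diff {C : Set ℂ} (hC : Convex ℝ C) {b : ℂ}
    {r : ℝ} (hr : 0 < r) (hrC : Metric.closedBall b r ⊆ C) : IsPathConnected (C \ {b}) := by
  have hS : Metric.closedBall b r \ {b} ⊆ C \ {b} := Set.sdiff_subset_sdiff_left hrC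
  have hrank : 1 < Module.rank ℝ ℂ := by
    rw [Complex.rank_real_complex]
    norm_num
  have hsph : Metric.sphere b r ⊆ C \ {b} := fun z hz => hS
    ⟨Metric.sphere_subset_closedBall hz, fun h => by
      rw [Set.mem_singleton_iff.1 h] at hz
      simp [hr.ne] at hz⟩
  refine ⟨b + r, add_ofReal_mem hr hS, ?_⟩
  intro z hz
  have hzb : z - b ≠ 0 := sub_ne_zero.2 hz.2
  have hn : 0 < ‖z - b‖ := norm_pos_iff.2 hzb
  let w : ℂ := b + ((r / ‖z - b‖ : ℝ) : ℂ) * (z - b)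
  have hwr : ‖w - b‖ = r := by
    simp only [w, add_sub_cancel_left, norm_mul, Complex.norm_real, Real.norm_eq_abs]
    rw [abs_of_pos (div_pos hr hn), div_mul_cancel₀ _ hn.ne']
  have h1 : JoinedIn (C \ {b}) (b + r) w := by
    refine ((isPathConnected_sphere hrank b hr.le).joinedIn _ ?_ _ ?_).mono hsph
    · simp [abs_of_pos hr]
    · simpa [dist_eq_norm] using hwr
  refine h1.trans (JoinedIn.symm ?_)
  refine ⟨⟨⟨fun u => AffineMap.lineMap z w (u : ℝ), by
    exact AffineMap.lineMap_continuous.comp continuous_subtype_val⟩, by simp, by simp⟩, fun u => ?_⟩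
  exact mem_diff_of_segment hC hz.1 hz.2 hrC (div_pos hr hn) rfl hwr u

/-- The fundamental group of a punctured convex set is generated by a circle. -/
theorem closure_circlePath_eq_top {C : Set ℂ} (hC : Convex ℝ C) {b : ℂ}
    {r : ℝ} (hr : 0 < r) (hrC : Metric.closedBall b r ⊆ C) :
    Subgroup.closure {loopElt (circlePath (S := C \ {b}) hr (Set.sdiff_subset_sdiff_left hrC))} = ⊤ := by
  have hS : Metric.closedBall b r \ {b} ⊆ C \ {b} := Set.sdiff_subset_sdiff_left hrC
  rw [eq_top_iff]
  rintro a -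
  obtain ⟨f, rfl⟩ : ∃ f, loopElt f = a := Path.Homotopic.Quotient.mk_surjective a
  have hrc : (r : ℂ) ≠ 0 := by exact_mod_cast hr.ne'
  obtain ⟨L', hL'⟩ := exists_log_path ⟨fun t => ((f t : ℂ) - b) / r, by fun_prop⟩
    (fun t => div_ne_zero (sub_ne_zero.2 (f t).2.2) hrc)
  simp only [ContinuousMap.coe_mk] at hL'
  have hL'0 : Complex.exp (L' 0) = 1 := by
    rw [hL', f.source]
    simp [hrc]
  -- `exp (L' 0) = 1` only makes `L' 0` a multiple of `2πi`; subtracting it makes the angle start at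
  -- `0`.
  let L : C(I, ℂ) := ⟨fun t => L' t - L' 0, by fun_prop⟩
  have hL : ∀ t, (f t : ℂ) = b + r * Complex.exp (L t) := fun t => by
    simp only [L, ContinuousMap.coe_mk]
    rw [Complex.exp_sub, hL'0, div_one, hL']
    field_simp
    ring
  have hL0 : L 0 = 0 := by simp [L]
  have hL1 : Complex.exp (L 1) = 1 := by
    have := hL 1
    rw [f.target] at this
    simp only at this
    have h2 : (r : ℂ) * (Complex.exp (L 1) - 1) = 0 := by linear_combination -this
    exact sub_eq_zero.1 ((mul_eq_zero.1 h2).resolve_left hrc)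
  obtain ⟨n, hn⟩ := Complex.exp_eq_one_iff.1 hL1
  have hpi : (2 * Real.pi : ℝ) ≠ 0 := by positivity
  let θ : C(I, ℝ) := ⟨fun t => (L t).im / (2 * Real.pi), by fun_prop⟩
  have hθ0 : θ 0 = 0 := by simp [θ, hL0]
  have hθ1 : θ 1 = n := by
    simp only [θ, ContinuousMap.coe_mk, hn]
    rw [div_eq_iff hpi]
    simp
  have hθ : ∀ t, (2 * Real.pi * Complex.I * (θ t : ℝ) : ℂ) = ((L t).im : ℂ) * Complex.I := by
    intro t
    have : (2 * Real.pi : ℂ) ≠ 0 := by exact_mod_cast hpi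
    simp only [θ, ContinuousMap.coe_mk]
    push_cast
    field_simp
  have hexp : ∀ t, Complex.exp (L t) =
      (Real.exp (L t).re : ℂ) * Complex.exp (2 * Real.pi * Complex.I * (θ t : ℝ)) := by
    intro t
    rw [hθ, Complex.ofReal_exp, ← Complex.exp_add, Complex.re_add_im]
  -- The radial homotopy replaces the modulus `r * exp (Re L)` by `r` and keeps the angle.
  have hom : f.Homotopic (turnPath hr hS θ hθ0 n hθ1) := by
    refine homotopic_of_map (fun v => AffineMap.lineMap (f v.2 : ℂ)
      (b + r * Complex.exp (2 * Real.pi * Complex.I * (θ v.2 : ℝ))) (v.1 : ℝ)) ?_ ?_ ?_ ?_ ?_ ?_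
    · simp only [AffineMap.lineMap_apply_module]
      fun_prop
    · intro v
      refine mem_diff_of_segment hC (f v.2).2.1 (f v.2).2.2 hrC
        (Real.exp_pos (-(L v.2).re)) ?_ ?_ v.1
      · rw [hL, hexp, add_sub_cancel_left]
        have : (Real.exp (-(L v.2).re) : ℂ) * Real.exp (L v.2).re = 1 := by
          rw [← Complex.ofReal_mul, ← Real.exp_add]
          simp
        linear_combination (-(r : ℂ) *
          Complex.exp (2 * Real.pi * Complex.I * (θ v.2 : ℝ))) * this
      · rw [add_sub_cancel_left, norm_ofReal_mul_exp, abs_of_pos hr]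
    · intro t
      simp
    · intro t
      simp [turnPath]
    · intro u
      simp [hθ0]
    · intro u
      simp only [hθ1, exp_two_pi_mul_int, mul_one, Path.target, AffineMap.lineMap_same,
        AffineMap.const_apply]
  rw [loopElt_eq hom]
  have := loopElt_powPath_mem hr hS n
  rwa [powPath, loopElt_eq (turnPath_homotopic hr hS _ θ _ hθ0 n _ hθ1)] at this

end Base
end CanonicalCycles
end

noncomputable section

namespace CanonicalCycles

open scoped unitInterval Simplicial

/-! ### Induction on the number of punctures -/

section Punctured

/-- `S` is path connected and, at each base point, its fundamental group is generated by loops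
which are freely homotopic to small circles around the points `b i`, `i ∈ s`. -/
def CirclesGenerate {ι : Type} (b : ι → ℂ) (s : Set ι) (S : Set ℂ) : Prop :=
  IsPathConnected S ∧ ∀ x : S, ∃ g : ι → Path x x,
    (∀ i ∈ s, ∃ (r : ℝ) (hr : 0 < r) (h : Metric.closedBall (b i) r \ {b i} ⊆ S),
      FreelyHomotopic (g i) (circlePath hr h)) ∧
    Subgroup.closure ((fun i => loopElt (g i)) '' s) = ⊤

theorem circlesGenerate_of_exists {ι : Type} {b : ι → ℂ} {s : Set ι} {S : Set ℂ}
    (hS : IsPathConnected S) {x : S} {g : ι → Path x x}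
    (hg : ∀ i ∈ s, ∃ (r : ℝ) (hr : 0 < r) (h : Metric.closedBall (b i) r \ {b i} ⊆ S),
      FreelyHomotopic (g i) (circlePath hr h))
    (hc : Subgroup.closure ((fun i => loopElt (g i)) '' s) = ⊤) : CirclesGenerate b s S := by
  refine ⟨hS, fun z => ?_⟩
  have := isPathConnected_iff_pathConnectedSpace.1 hS
  obtain ⟨g', h1, h2⟩ := exists_generate_at g hc z
  refine ⟨g', fun i hi => ?_, h2⟩
  obtain ⟨r, hr, h, hh⟩ := hg i hi
  exact ⟨r, hr, h, (h1 i).trans hh⟩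

theorem circlesGenerate_convex {ι : Type} (b : ι → ℂ) {C : Set ℂ} (hC : Convex ℝ C)
    (hne : C.Nonempty) : CirclesGenerate b ∅ C := by
  refine ⟨hC.isPathConnected hne, fun x => ⟨fun _ => Path.refl x, by simp, ?_⟩⟩
  rw [eq_top_iff]
  rintro a -
  obtain ⟨f, rfl⟩ : ∃ f, loopElt f = a := Path.Homotopic.Quotient.mk_surjective a
  have : f.Homotopic (Path.refl x) := by
    refine homotopic_of_map (fun v => AffineMap.lineMap (f v.2 : ℂ) (x : ℂ) (v.1 : ℝ)) ?_
      (fun v => hC.lineMap_mem (f v.2).2 x.2 v.1.2) ?_ ?_ ?_ ?_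
    · simp only [AffineMap.lineMap_apply_module]
      fun_prop
    all_goals simp
  rw [loopElt_eq this]
  exact one_mem _

theorem circlesGenerate_singleton {ι : Type} (b : ι → ℂ) (i : ι) {C : Set ℂ} (hC : Convex ℝ C)
    (ho : IsOpen C) (hi : b i ∈ C) : CirclesGenerate b {i} (C \ {b i}) := by
  obtain ⟨r, hr, hrC⟩ := Metric.nhds_basis_closedBall.mem_iff.1 (ho.mem_nhds hi)
  have hS : Metric.closedBall (b i) r \ {b i} ⊆ C \ {b i} := Set.sdiff_subset_sdiff_left hrC
  refine circlesGenerate_of_exists (isPathConnected_convex_diff hC hr hrC)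
    (g := fun _ => circlePath hr hS) ?_ ?_
  · rintro j rfl
    exact ⟨r, hr, hS, FreelyHomotopic.of_eq fun _ => rfl⟩
  · rw [Set.image_singleton]
    exact closure_circlePath_eq_top hC hr hrC

theorem CirclesGenerate.union {ι : Type} {b : ι → ℂ} {s₁ s₂ : Set ι} {S₁ S₂ : Set ℂ}
    (h₁ : CirclesGenerate b s₁ S₁) (h₂ : CirclesGenerate b s₂ S₂) (hd : Disjoint s₁ s₂)
    (ho₁ : IsOpen S₁) (ho₂ : IsOpen S₂) (hp : IsPathConnected (S₁ ∩ S₂)) :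
    CirclesGenerate b (s₁ ∪ s₂) (S₁ ∪ S₂) := by
  classical
  obtain ⟨x, hx⟩ := hp.nonempty
  obtain ⟨g₁, hg₁, hc₁⟩ := h₁.2 ⟨x, hx.1⟩
  obtain ⟨g₂, hg₂, hc₂⟩ := h₂.2 ⟨x, hx.2⟩
  let j₁ : C(S₁, (S₁ ∪ S₂ : Set ℂ)) := ⟨Set.inclusion Set.subset_union_left, by fun_prop⟩
  let j₂ : C(S₂, (S₁ ∪ S₂ : Set ℂ)) := ⟨Set.inclusion Set.subset_union_right, by fun_prop⟩
  let x₀ : (S₁ ∪ S₂ : Set ℂ) := ⟨x, Or.inl hx.1⟩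
  -- Disjointness of `s₁` and `s₂` makes this choice correct on both; its values at other indices do
  -- not enter the generating set.
  let g : ι → Path x₀ x₀ := fun i =>
    if i ∈ s₁ then (g₁ i).map j₁.continuous else (g₂ i).map j₂.continuous
  refine circlesGenerate_of_exists (h₁.1.union h₂.1 hp.nonempty) (g := g) ?_ ?_
  · rintro i (hi | hi)
    · obtain ⟨r, hr, h, hh⟩ := hg₁ i hi
      refine ⟨r, hr, h.trans Set.subset_union_left, ?_⟩
      simp only [g, if_pos hi]
      exact (hh.map j₁).trans (FreelyHomotopic.of_eq fun _ => rfl)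
    · obtain ⟨r, hr, h, hh⟩ := hg₂ i hi
      refine ⟨r, hr, h.trans Set.subset_union_right, ?_⟩
      simp only [g, if_neg (Set.disjoint_right.1 hd hi)]
      exact (hh.map j₂).trans (FreelyHomotopic.of_eq fun _ => rfl)
  · refine eq_top_of_union rfl ho₁ ho₂ h₁.1 h₂.1 hp x₀ hx _ ?_ ?_
    · intro f hf
      let f' : Path (⟨x, hx.1⟩ : S₁) ⟨x, hx.1⟩ := ⟨⟨fun t => ⟨f t, hf t⟩, by fun_prop⟩,
        Subtype.ext (congrArg (fun z : (S₁ ∪ S₂ : Set ℂ) => (z : ℂ)) f.source), Subtype.ext (congrArg (fun z : (S₁ ∪ S₂ : Set ℂ) => (z : ℂ)) f.target)⟩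
      have e : loopElt f = FundamentalGroup.map j₁ _ (loopElt f') := rfl
      have hm : loopElt f' ∈ Subgroup.closure ((fun i => loopElt (g₁ i)) '' s₁) :=
        hc₁ ▸ Subgroup.mem_top _
      rw [e]
      have hm' := Subgroup.mem_map_of_mem (FundamentalGroup.map j₁ _) hm
      rw [MonoidHom.map_closure] at hm'
      refine Subgroup.closure_mono ?_ hm'
      rintro _ ⟨_, ⟨i, hi, rfl⟩, rfl⟩
      refine ⟨i, Or.inl hi, ?_⟩
      simp only [g, if_pos hi]
      rfl
    · intro f hf
      let f' : Path (⟨x, hx.2⟩ : S₂) ⟨x, hx.2⟩ := ⟨⟨fun t => ⟨f t, hf t⟩, by fun_prop⟩,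
        Subtype.ext (congrArg (fun z : (S₁ ∪ S₂ : Set ℂ) => (z : ℂ)) f.source), Subtype.ext (congrArg (fun z : (S₁ ∪ S₂ : Set ℂ) => (z : ℂ)) f.target)⟩
      have e : loopElt f = FundamentalGroup.map j₂ _ (loopElt f') := rfl
      have hm : loopElt f' ∈ Subgroup.closure ((fun i => loopElt (g₂ i)) '' s₂) :=
        hc₂ ▸ Subgroup.mem_top _
      rw [e]
      have hm' := Subgroup.mem_map_of_mem (FundamentalGroup.map j₂ _) hm
      rw [MonoidHom.map_closure] at hm'
      refine Subgroup.closure_mono ?_ hm'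
      rintro _ ⟨_, ⟨i, hi, rfl⟩, rfl⟩
      refine ⟨i, Or.inr hi, ?_⟩
      simp only [g, if_neg (Set.disjoint_right.1 hd hi)]
      rfl

/-- Small circles around the punctures generate the fundamental group of a convex open set
without finitely many of its points. -/
theorem circlesGenerate_convex_diff {ι : Type} {b : ι → ℂ} (hb : Function.Injective b)
    (s : Finset ι) {C : Set ℂ} (hC : Convex ℝ C) (ho : IsOpen C) (hne : C.Nonempty)
    (hs : ∀ i ∈ s, b i ∈ C) : CirclesGenerate b s (C \ b '' s) := by
  classical
  induction hn : s.card using Nat.strong_induction_on generalizing s C with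
  | _ n ih =>
    rcases s.eq_empty_or_nonempty with rfl | ⟨i, hi⟩
    · simpa using circlesGenerate_convex b hC hne
    by_cases hex : ∃ j ∈ s, j ≠ i
    swap
    · obtain rfl : s = {i} := by
        ext j
        simp only [Finset.mem_singleton]
        constructor
        · intro hj
          by_contra h
          exact hex ⟨j, hj, h⟩
        · rintro rfl
          exact hi
      simpa using circlesGenerate_singleton b i hC ho (hs i hi)
    obtain ⟨j, hj, hji⟩ := hex
    let f : ℂ →L[ℝ] ℝ := innerSL ℝ (E := ℂ) (b j - b i)
    have hfij : f (b i) < f (b j) := by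
      have h1 : f (b j) - f (b i) = ‖b j - b i‖ ^ 2 := by
        rw [← map_sub]
        exact real_inner_self_eq_norm_sq (b j - b i)
      have h2 : 0 < ‖b j - b i‖ := norm_pos_iff.2 (sub_ne_zero.2 fun h => hji (hb h))
      have := pow_pos h2 2
      linarith
    let t : Finset ι := s.filter fun k => f (b i) < f (b k)
    -- `f (b k)` is the next level of punctures above `f (b i)`, so the open strip between the two
    -- levels contains no puncture. The half-planes `f < β` and `α < f` overlap in this strip; the
    -- first omits `b k` and the second omits `b i`, so both pieces have fewer punctures.
    obtain ⟨k, hk, hkmin⟩ := t.exists_min_image (fun k => f (b k))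
      ⟨j, Finset.mem_filter.2 ⟨hj, hfij⟩⟩
    obtain ⟨hks, hik⟩ := Finset.mem_filter.1 hk
    set α := f (b i)
    set β := f (b k)
    let s₁ := s.filter fun l => f (b l) < β
    let s₂ := s.filter fun l => α < f (b l)
    let C₁ := C ∩ {z | f z < β}
    let C₂ := C ∩ {z | α < f z}
    have hle : ∀ l ∈ s, f (b l) < β → f (b l) ≤ α := by
      intro l hl h
      by_contra h'
      exact absurd (hkmin l (Finset.mem_filter.2 ⟨hl, not_le.1 h'⟩)) (not_le.2 h)
    have hC₁ : Convex ℝ C₁ := hC.inter (convex_halfSpace_lt f.toLinearMap.isLinear β)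
    have hC₂ : Convex ℝ C₂ := hC.inter (convex_halfSpace_gt f.toLinearMap.isLinear α)
    have ho₁ : IsOpen C₁ := ho.inter (isOpen_lt f.continuous continuous_const)
    have ho₂ : IsOpen C₂ := ho.inter (isOpen_lt continuous_const f.continuous)
    have hi₁ : i ∈ s₁ := Finset.mem_filter.2 ⟨hi, hik⟩
    have hk₂ : k ∈ s₂ := Finset.mem_filter.2 ⟨hks, hik⟩
    have hclosed : ∀ u : Finset ι, IsClosed (b '' (u : Set ι)) := fun u =>
      (u.finite_toSet.image b).isClosed
    have g₁ := ih s₁.card (by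
      rw [← hn]
      refine Finset.card_lt_card (Finset.filter_ssubset.2 ⟨k, hks, lt_irrefl _⟩)) s₁ hC₁ ho₁
      ⟨b i, hs i hi, hik⟩ (fun l hl => ⟨hs l (Finset.mem_filter.1 hl).1, (Finset.mem_filter.1 hl).2⟩) rfl
    have g₂ := ih s₂.card (by
      rw [← hn]
      refine Finset.card_lt_card (Finset.filter_ssubset.2 ⟨i, hi, lt_irrefl _⟩)) s₂ hC₂ ho₂
      ⟨b k, hs k hks, hik⟩ (fun l hl => ⟨hs l (Finset.mem_filter.1 hl).1, (Finset.mem_filter.1 hl).2⟩) rfl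
    have hinter : (C₁ \ b '' s₁) ∩ (C₂ \ b '' s₂) = C₁ ∩ C₂ := by
      ext z
      constructor
      · rintro ⟨h1, h2⟩
        exact ⟨h1.1, h2.1⟩
      · rintro ⟨h1, h2⟩
        refine ⟨⟨h1, ?_⟩, h2, ?_⟩
        · rintro ⟨l, hl, rfl⟩
          obtain ⟨hl, hl'⟩ := Finset.mem_filter.1 (Finset.mem_coe.1 hl)
          exact absurd (hle l hl hl') (not_le.2 h2.2)
        · rintro ⟨l, hl, rfl⟩
          obtain ⟨hl, hl'⟩ := Finset.mem_filter.1 (Finset.mem_coe.1 hl)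
          exact absurd (hle l hl h1.2) (not_le.2 hl')
    have hmid : ((1 / 2 : ℝ) • b i + (1 / 2 : ℝ) • b k) ∈ C₁ ∩ C₂ := by
      have hm : ((1 / 2 : ℝ) • b i + (1 / 2 : ℝ) • b k) ∈ C :=
        hC (hs i hi) (hs k hks) (by norm_num) (by norm_num) (by norm_num)
      have hf : f ((1 / 2 : ℝ) • b i + (1 / 2 : ℝ) • b k) = (α + β) / 2 := by
        rw [map_add, map_smul, map_smul, smul_eq_mul, smul_eq_mul]
        ring
      refine ⟨⟨hm, ?_⟩, hm, ?_⟩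
      · rw [Set.mem_ofPred_eq, hf]
        linarith
      · rw [Set.mem_ofPred_eq, hf]
        linarith
    have hU := g₁.union g₂ (Set.disjoint_left.2 fun l h1 h2 =>
      absurd (hle l (Finset.mem_filter.1 (Finset.mem_coe.1 h1)).1
        (Finset.mem_filter.1 (Finset.mem_coe.1 h1)).2)
        (not_le.2 (Finset.mem_filter.1 (Finset.mem_coe.1 h2)).2))
      (ho₁.sdiff (hclosed _)) (ho₂.sdiff (hclosed _))
      (hinter ▸ (hC₁.inter hC₂).isPathConnected ⟨_, hmid⟩)
    have e1 : (s₁ : Set ι) ∪ s₂ = s := by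
      ext l
      simp only [Set.mem_union, Finset.mem_coe, s₁, s₂, Finset.mem_filter]
      constructor
      · rintro (h | h) <;> exact h.1
      · intro hl
        rcases lt_or_ge (f (b l)) β with h | h
        · exact Or.inl ⟨hl, h⟩
        · exact Or.inr ⟨hl, hik.trans_le h⟩
    have e2 : (C₁ \ b '' s₁) ∪ (C₂ \ b '' s₂) = C \ b '' s := by
      ext z
      constructor
      · rintro (⟨h1, h2⟩ | ⟨h1, h2⟩)
        · refine ⟨h1.1, ?_⟩
          rintro ⟨l, hl, rfl⟩
          exact h2 ⟨l, Finset.mem_coe.2 (Finset.mem_filter.2 ⟨hl, h1.2⟩), rfl⟩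
        · refine ⟨h1.1, ?_⟩
          rintro ⟨l, hl, rfl⟩
          exact h2 ⟨l, Finset.mem_coe.2 (Finset.mem_filter.2 ⟨hl, h1.2⟩), rfl⟩
      · rintro ⟨h1, h2⟩
        have h3 : ∀ u ⊆ s, z ∉ b '' (u : Set ι) := fun u hu h =>
          h2 (Set.image_mono (Finset.coe_subset.2 hu) h)
        rcases lt_or_ge (f z) β with h | h
        · exact Or.inl ⟨⟨h1, h⟩, h3 _ (Finset.filter_subset _ _)⟩
        · exact Or.inr ⟨⟨h1, hik.trans_le h⟩, h3 _ (Finset.filter_subset _ _)⟩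
    rwa [e1, e2] at hU

end Punctured
end CanonicalCycles
end

noncomputable section

namespace CanonicalCycles

open scoped unitInterval Simplicial

/-! ### Circles in the finitely punctured plane -/

section Plane

theorem logVar_circle_self {r : ℝ} (hr : 0 < r) (b : ℂ) :
    logVar (fun s => b + r * Complex.exp (2 * Real.pi * Complex.I * (s : ℝ)) - b) =
      2 * Real.pi * Complex.I := by
  have h : (r : ℂ) ≠ 0 := by exact_mod_cast hr.ne'
  rw [logVar_eq ⟨fun s => Complex.log r + 2 * Real.pi * Complex.I * (s : ℝ), by fun_prop⟩]
  · simp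
  · intro s
    simp only [ContinuousMap.coe_mk]
    rw [Complex.exp_add, Complex.exp_log h]
    ring

/-- After division by `b - b'` the circle lies in the unit disc about `1`, where the principal
logarithm is continuous and single-valued. -/
theorem logVar_circle_of_lt {r : ℝ} (hr : 0 < r) {b b' : ℂ} (h : r < dist b b') :
    logVar (fun s => b + r * Complex.exp (2 * Real.pi * Complex.I * (s : ℝ)) - b') = 0 := by
  have hd : b - b' ≠ 0 := by
    rw [sub_ne_zero]
    rintro rfl
    rw [dist_self] at h
    exact absurd h hr.not_gt
  have hmem : ∀ s : I, 1 + r * Complex.exp (2 * Real.pi * Complex.I * (s : ℝ)) / (b - b') ∈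
      Complex.slitPlane := by
    intro s
    refine Complex.mem_slitPlane_of_norm_lt_one ?_
    rw [norm_div, norm_ofReal_mul_exp, abs_of_pos hr, div_lt_one (norm_pos_iff.2 hd),
      ← dist_eq_norm]
    exact h
  rw [logVar_eq ⟨fun s => Complex.log (b - b') +
    Complex.log (1 + r * Complex.exp (2 * Real.pi * Complex.I * (s : ℝ)) / (b - b')), by
      refine continuous_const.add (Continuous.clog ?_ hmem)
      fun_prop⟩]
  · simp [Complex.exp_two_pi_mul_I]
  · intro s
    simp only [ContinuousMap.coe_mk]
    rw [Complex.exp_add, Complex.exp_log hd, Complex.exp_log (Complex.slitPlane_ne_zero (hmem s))]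
    field_simp
    ring

theorem circle_subset_compl_range {m : ℕ} {b : Fin m → ℂ} {ρ : Fin m → ℝ} 
    (hρ : ∀ i j, j ≠ i → ρ i < dist (b i) (b j)) (i : Fin m) :
    Metric.closedBall (b i) (ρ i) \ {b i} ⊆ (Set.range b)ᶜ := by
  rintro _ ⟨h1, h2⟩ ⟨j, rfl⟩
  have hj : j ≠ i := by
    rintro rfl
    exact h2 rfl
  have := hρ i j hj
  rw [Metric.mem_closedBall, dist_comm] at h1
  exact absurd h1 (not_le.2 this)

theorem circlesGenerate_compl_range {m : ℕ} {b : Fin m → ℂ} (hb : Function.Injective b) :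
    CirclesGenerate b Set.univ (Set.range b)ᶜ := by
  have := circlesGenerate_convex_diff hb Finset.univ convex_univ isOpen_univ Set.univ_nonempty
    (fun i _ => Set.mem_univ _)
  simpa [← Set.compl_eq_univ_sdiff] using this

/-- A homeomorphism from the plane without the points `b i` carries the circles around these
points to generating cycles. -/
theorem cycles_of_homeomorph {m : ℕ} {b : Fin m → ℂ} (hb : Function.Injective b)
    {ρ : Fin m → ℝ} (hpos : ∀ i, 0 < ρ i) (hρ : ∀ i j, j ≠ i → ρ i < dist (b i) (b j))
    {Y : Set (ℂ × ℂ)} (e : ((Set.range b)ᶜ : Set ℂ) ≃ₜ Y) (γ : Fin m → I → ℂ × ℂ)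
    (hγ : ∀ i s, γ i s = e (circlePath (hpos i) (circle_subset_compl_range hρ i) s)) :
    IsPathConnected Y ∧ ∃ (y : Fin m → Y) (l : ∀ i, Path (y i) (y i)),
    (∀ i s, (l i s : ℂ × ℂ) = γ i s) ∧
    (∀ i z, ¬ FreelyHomotopic (l i) (Path.refl z)) ∧
    (∀ x : Y, ∃ g : Fin m → Path x x,
      (∀ i, FreelyHomotopic (g i) (l i)) ∧
      Subgroup.closure (Set.range fun i =>
        (FundamentalGroup.fromPath (Path.Homotopic.Quotient.mk (g i)) : FundamentalGroup Y x))
          = ⊤) ∧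
    ∃ b : Module.Basis (Fin m) ℤ (H1 Y), ∀ i, b i = loopClass (l i) := by
  obtain ⟨hpc, hgen⟩ := circlesGenerate_compl_range hb
  have := isPathConnected_iff_pathConnectedSpace.1 hpc
  have hY : PathConnectedSpace Y := e.surjective.pathConnectedSpace e.continuous
  obtain ⟨x⟩ : Nonempty ((Set.range b)ᶜ : Set ℂ) := inferInstance
  obtain ⟨g, hg, hc⟩ := hgen x
  let E : C(((Set.range b)ᶜ : Set ℂ), Y) := ⟨e, e.continuous⟩
  let l := fun i => (circlePath (hpos i) (circle_subset_compl_range hρ i)).map e.continuous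
  have hgl : ∀ i, FreelyHomotopic ((g i).map e.continuous) (l i) := by
    intro i
    obtain ⟨r, hr, h, hh⟩ := hg i trivial
    exact (hh.trans (circlePath_freelyHomotopic _ _ _ _)).map E
  have hc' : Subgroup.closure ((fun i => loopElt ((g i).map e.continuous)) '' Set.univ) = ⊤ := by
    have h1 : (fun i => loopElt ((g i).map e.continuous)) '' Set.univ =
        FundamentalGroup.map E x '' ((fun i => loopElt (g i)) '' Set.univ) := by
      rw [Set.image_image]
      rfl
    rw [h1, ← MonoidHom.map_closure, hc, ← MonoidHom.range_eq_map, MonoidHom.range_eq_top]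
    intro a
    obtain ⟨f, rfl⟩ : ∃ f, loopElt f = a := Path.Homotopic.Quotient.mk_surjective a
    let f' : Path x x := (f.map e.symm.continuous).cast (e.symm_apply_apply x).symm
      (e.symm_apply_apply x).symm
    refine ⟨loopElt f', ?_⟩
    change loopElt (f'.map E.continuous) = loopElt f
    have hf : f'.map E.continuous = f := Path.ext (funext fun t => e.apply_symm_apply (f t))
    rw [hf]
  have hgens : ∀ z : Y, ∃ g : Fin m → Path z z, (∀ i, FreelyHomotopic (g i) (l i)) ∧
      Subgroup.closure (Set.range fun i => loopElt (g i)) = ⊤ := by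
    intro z
    obtain ⟨g', h1, h2⟩ := exists_generate_at (fun i => (g i).map e.continuous) hc' z
    rw [Set.image_univ] at h2
    exact ⟨g', fun i => (h1 i).trans (hgl i), h2⟩
  obtain ⟨g₀, hg₀, hc₀⟩ := hgens (e x)
  obtain ⟨hnc, hbas⟩ := cycles_of_generate hg₀ hc₀
    (fun j => ⟨fun z => (e.symm z : ℂ) - b j, by fun_prop⟩)
    (fun j z => sub_ne_zero.2 fun h => (e.symm z).2 ⟨j, h.symm⟩)
    (by
      intro i j
      have : ∀ t, (e.symm (l i t) : ℂ) = b i + ρ i *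
          Complex.exp (2 * Real.pi * Complex.I * (t : ℝ)) := fun t =>
        congrArg Subtype.val (e.symm_apply_apply _)
      simp only [ContinuousMap.coe_mk, this]
      split_ifs with h
      · subst h
        exact logVar_circle_self (hpos i) _
      · exact logVar_circle_of_lt (hpos i) (hρ i j (Ne.symm h)))
  exact ⟨isPathConnected_iff_pathConnectedSpace.2 hY, _, l, fun i s => (hγ i s).symm, hnc, hgens,
    hbas⟩

end Plane
end CanonicalCycles
end

noncomputable section

namespace CanonicalCycles

/-! ### Generic values and reducible fibres -/

section Polynomials

theorem contDiff_ev (H : Poly2) {n : WithTop ℕ∞} : ContDiff ℂ n (ev H) := by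
  unfold ev
  induction H using MvPolynomial.induction_on with
  | C a => simpa using contDiff_const
  | add p q hp hq => simpa using hp.add hq
  | mul_X p i hp =>
    simp only [map_mul, MvPolynomial.eval_X]
    refine hp.mul ?_
    fin_cases i
    · exact contDiff_fst
    · exact contDiff_snd

theorem continuous_ev (H : Poly2) : Continuous (ev H) := (contDiff_ev H (n := 0)).continuous

/-- The linear form with given coefficients. -/
def linForm (a b : ℂ) : ℂ × ℂ →L[ℂ] ℂ :=
  a • ContinuousLinearMap.fst ℂ ℂ ℂ + b • ContinuousLinearMap.snd ℂ ℂ ℂ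

theorem linForm_apply (a b : ℂ) (v : ℂ × ℂ) : linForm a b v = a * v.1 + b * v.2 := rfl

theorem linForm_zero : linForm 0 0 = 0 := by
  refine ContinuousLinearMap.ext fun v => ?_
  rw [linForm_apply, zero_mul, zero_mul, add_zero]
  rfl

theorem hasFDerivAt_ev (H : Poly2) (z : ℂ × ℂ) :
    HasFDerivAt (ev H) (linForm (ev (MvPolynomial.pderiv 0 H) z)
      (ev (MvPolynomial.pderiv 1 H) z)) z := by
  unfold ev
  induction H using MvPolynomial.induction_on with
  | C a => simpa [linForm_zero] using hasFDerivAt_const a z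
  | add p q hp hq =>
    simp only [map_add]
    refine (hp.add hq).congr_fderiv (ContinuousLinearMap.ext fun v => ?_)
    rw [add_apply, linForm_apply, linForm_apply, linForm_apply]
    ring
  | mul_X p i hp =>
    have hX : HasFDerivAt (fun w : ℂ × ℂ => (![w.1, w.2] : Fin 2 → ℂ) i)
        (linForm (if i = 0 then 1 else 0) (if i = 1 then 1 else 0)) z := by
      fin_cases i
      · refine hasFDerivAt_fst.congr_fderiv (ContinuousLinearMap.ext fun v => ?_)
        simp [linForm_apply]
      · refine hasFDerivAt_snd.congr_fderiv (ContinuousLinearMap.ext fun v => ?_)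
        simp [linForm_apply]
    simp only [map_mul, MvPolynomial.eval_X]
    refine (hp.mul hX).congr_fderiv (ContinuousLinearMap.ext fun v => ?_)
    simp only [Derivation.leibniz, MvPolynomial.pderiv_X, smul_eq_mul, map_add, map_mul,
      MvPolynomial.eval_X, linForm_apply, add_apply,
      smul_apply]
    fin_cases i <;> simp <;> ring

/-- The form without coordinates lets the chain rule handle polynomial automorphisms and products.
-/
theorem mem_criticalValues_iff {H : Poly2} {c : ℂ} :
    c ∈ criticalValues H ↔ ∃ z, ev H z = c ∧ HasFDerivAt (ev H) (0 : ℂ × ℂ →L[ℂ] ℂ) z := by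
  constructor
  · rintro ⟨z, h, h0, h1⟩
    refine ⟨z, h, ?_⟩
    have := hasFDerivAt_ev H z
    rwa [h0, h1, linForm_zero] at this
  · rintro ⟨z, h, h0⟩
    have e := (hasFDerivAt_ev H z).unique h0
    refine ⟨z, h, ?_, ?_⟩
    · simpa [linForm_apply] using DFunLike.congr_fun e (1, 0)
    · simpa [linForm_apply] using DFunLike.congr_fun e (0, 1)

theorem SmoothOnSubset.continuousOn {E F : Type*} [NormedAddCommGroup E] [NormedSpace ℝ E]
    [NormedAddCommGroup F] [NormedSpace ℝ F] {f : E → F} {S : Set E} (h : SmoothOnSubset f S) :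
    ContinuousOn f S := by
  intro x hx
  obtain ⟨V, hV, hxV, g, hg, he⟩ := h x hx
  have h1 : ContinuousWithinAt g (V ∩ S) x := (hg.continuousOn x hxV).mono Set.inter_subset_left
  have h2 : ContinuousWithinAt f (V ∩ S) x := h1.congr he (he ⟨hxV, hx⟩)
  exact (continuousWithinAt_inter' (mem_nhdsWithin_of_mem_nhds (hV.mem_nhds hxV))).1
    (Set.inter_comm V S ▸ h2)

theorem SmoothOnSubset.comp_contDiff {E F G : Type*} [NormedAddCommGroup E] [NormedSpace ℝ E]
    [NormedAddCommGroup F] [NormedSpace ℝ F] [NormedAddCommGroup G] [NormedSpace ℝ G]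
    {f : E → F} {S : Set E} (h : SmoothOnSubset f S) {g : G → E} (hg : ContDiff ℝ ∞ g)
    {S' : Set G} (hS : Set.MapsTo g S' S) : SmoothOnSubset (f ∘ g) S' := by
  intro x hx
  obtain ⟨V, hV, hxV, k, hk, he⟩ := h (g x) (hS hx)
  exact ⟨g ⁻¹' V, hV.preimage hg.continuous, hxV, k ∘ g,
    hk.comp hg.contDiffOn (fun _ h => h), fun y hy => he ⟨hy.1, hS hy.2⟩⟩

theorem SmoothOnSubset.contDiff_comp {E F G : Type*} [NormedAddCommGroup E] [NormedSpace ℝ E]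
    [NormedAddCommGroup F] [NormedSpace ℝ F] [NormedAddCommGroup G] [NormedSpace ℝ G]
    {f : E → F} {S : Set E} (h : SmoothOnSubset f S) {g : F → G} (hg : ContDiff ℝ ∞ g) :
    SmoothOnSubset (g ∘ f) S := by
  intro x hx
  obtain ⟨V, hV, hxV, k, hk, he⟩ := h x hx
  exact ⟨V, hV, hxV, g ∘ k, hg.comp_contDiffOn hk, fun y hy => congrArg g (he hy)⟩

theorem IsPolyMap.contDiff {f : ℂ × ℂ → ℂ × ℂ} (h : IsPolyMap f) {n : WithTop ℕ∞} :
    ContDiff ℂ n f := by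
  obtain ⟨A, B, h⟩ := h
  rw [funext h]
  exact (contDiff_ev A).prodMk (contDiff_ev B)

theorem contDiff_of_eval {f : ℂ → ℂ} (h : ∃ p : Polynomial ℂ, ∀ c, f c = p.eval c)
    {n : WithTop ℕ∞} : ContDiff ℂ n f := by
  obtain ⟨p, h⟩ := h
  rw [funext h]
  simpa using p.contDiff_aeval (𝕜 := ℂ) n

/-- Generic values are preserved by polynomial changes of coordinates. -/
theorem map_mem_genericValues {K H : Poly2} {ψ : ℂ × ℂ ≃ ℂ × ℂ} {σ : ℂ ≃ ℂ} (hψ : IsPolyAut2 ψ)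
    (hσ : IsPolyAut1 σ) (h : ∀ z, ev K z = σ (ev H (ψ.symm z))) {c : ℂ}
    (hc : c ∈ genericValues H) : σ c ∈ genericValues K := by
  have h' : ∀ w, ev H w = σ.symm (ev K (ψ w)) := fun w => by simp [h]
  have hcrit : c ∉ criticalValues H := fun h => hc (Or.inl h)
  have htriv : LocallyTrivialAt H c := by
    by_contra h
    exact hc (Or.inr h)
  rintro (h1 | h1)
  · apply hcrit
    rw [mem_criticalValues_iff] at h1 ⊢
    obtain ⟨z, hz, hd⟩ := h1
    refine ⟨ψ.symm z, σ.injective ((h z).symm.trans hz), ?_⟩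
    have d1 : HasFDerivAt ψ (fderiv ℂ ψ (ψ.symm z)) (ψ.symm z) :=
      ((hψ.1.contDiff (n := 1)).differentiable (by norm_num) _).hasFDerivAt
    have d2 : HasFDerivAt σ.symm (fderiv ℂ σ.symm (ev K z)) (ev K z) :=
      (((contDiff_of_eval hσ.2 (n := 1)).differentiable (by norm_num)) _).hasFDerivAt
    rw [funext h']
    rw [← ψ.apply_symm_apply z] at hd d2
    refine (d2.comp (ψ.symm z) (hd.comp (ψ.symm z) d1)).congr_fderiv
      (ContinuousLinearMap.ext fun v => ?_)
    simp
  · apply h1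
    obtain ⟨U, Φ, Ψ, hU, hcU, hΦ, hΨ, hl, hr⟩ := htriv
    have sψ : ContDiff ℝ ∞ ψ := (hψ.1.contDiff (n := ∞)).restrict_scalars ℝ
    have sψ' : ContDiff ℝ ∞ ψ.symm := (hψ.2.contDiff (n := ∞)).restrict_scalars ℝ
    have sσ' : ContDiff ℝ ∞ σ.symm := (contDiff_of_eval hσ.2 (n := ∞)).restrict_scalars ℝ
    have hfib : ∀ z, z ∈ fiber K (σ c) ↔ ψ.symm z ∈ fiber H c := fun z => by
      change ev K z = σ c ↔ ev H (ψ.symm z) = c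
      rw [h, σ.injective.eq_iff]
    refine ⟨σ.symm ⁻¹' U, fun w => ψ (Φ (ψ.symm w)), fun v => ψ (Ψ (σ.symm v.1, ψ.symm v.2)),
      hU.preimage sσ'.continuous, by simpa using hcU, ?_, ?_, ?_, ?_⟩
    · refine (hΦ.comp_contDiff sψ' ?_).contDiff_comp sψ
      intro w hw
      simpa [h] using hw
    · refine (hΨ.comp_contDiff (g := fun v : ℂ × (ℂ × ℂ) => (σ.symm v.1, ψ.symm v.2))
        ((sσ'.comp contDiff_fst).prodMk (sψ'.comp contDiff_snd)) ?_).contDiff_comp sψ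
      intro v hv
      exact ⟨hv.1, (hfib _).1 hv.2⟩
    · intro w hw
      have hw' : ev H (ψ.symm w) ∈ U := by simpa [h] using hw
      obtain ⟨h2, h3⟩ := hl _ hw'
      refine ⟨(hfib _).2 (by simpa using h2), ?_⟩
      simp only [h, Equiv.symm_apply_apply]
      rw [h3, Equiv.apply_symm_apply]
    · intro u hu z hz
      obtain ⟨h2, h3⟩ := hr _ hu _ ((hfib z).1 hz)
      constructor
      · rw [h, Equiv.symm_apply_apply, h2, Equiv.apply_symm_apply]
      · simp only [Equiv.symm_apply_apply]
        rw [h3, Equiv.apply_symm_apply]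

/-- If `H - c` is a product of two polynomials with zeros and almost all fibres of `H` are
connected, then `c` is a bifurcation value. -/
theorem mem_bifurcationSet_of_factor {H A B : Poly2} {c : ℂ}
    (hAB : ∀ z, ev H z = c + ev A z * ev B z) (hA : ∃ z, ev A z = 0) (hB : ∃ z, ev B z = 0)
    {E : Set ℂ} (hE : E.Finite) (hconn : ∀ c' ∉ E, IsPreconnected (fiber H c')) :
    c ∈ bifurcationSet H := by
  by_contra hc
  have htriv : LocallyTrivialAt H c := by
    by_contra h
    exact hc (Or.inr h)
  obtain ⟨U, Φ, Ψ, hU, hcU, hΦ, hΨ, hl, hr⟩ := htriv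
  obtain ⟨c', hc'U, hc'E⟩ : ∃ c' ∈ U, c' ∉ E := by
    have := hE.countable.dense_compl ℂ
    obtain ⟨c', h1, h2⟩ := this.inter_open_nonempty U hU ⟨c, hcU⟩
    exact ⟨c', h1, h2⟩
  have hpre : IsPreconnected (fiber H c) := by
    -- The trivialization maps the connected fibre over a nearby value `c' ∉ E` onto the fibre over
    -- `c`.
    have himg : Φ '' fiber H c' = fiber H c := by
      ext z
      constructor
      · rintro ⟨w, hw, rfl⟩
        exact (hl w (by rw [show ev H w = c' from hw]; exact hc'U)).1
      · intro hz
        exact ⟨Ψ (c', z), (hr c' hc'U z hz).1, (hr c' hc'U z hz).2⟩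
    rw [← himg]
    refine (hconn c' hc'E).image _ (hΦ.continuousOn.mono fun w hw => ?_)
    change ev H w ∈ U
    rwa [show ev H w = c' from hw]
  have hmem : ∀ z, z ∈ fiber H c ↔ ev A z = 0 ∨ ev B z = 0 := fun z => by
    change ev H z = c ↔ _
    rw [hAB, add_eq_left, mul_eq_zero]
  obtain ⟨a, ha⟩ := hA
  obtain ⟨b, hb⟩ := hB
  -- A connected set covered by two closed sets, both of which it meets, contains a point of both;
  -- there `d(AB) = A dB + B dA` vanishes.
  obtain ⟨z, -, hzA, hzB⟩ := isPreconnected_closed_iff.1 hpre {z | ev A z = 0} {z | ev B z = 0}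
    (isClosed_eq (continuous_ev A) continuous_const)
    (isClosed_eq (continuous_ev B) continuous_const)
    (fun z hz => (hmem z).1 hz) ⟨a, (hmem a).2 (Or.inl ha), ha⟩ ⟨b, (hmem b).2 (Or.inr hb), hb⟩
  refine hc (Or.inl (mem_criticalValues_iff.2 ⟨z, (hmem z).2 (Or.inl hzA), ?_⟩))
  have := ((hasFDerivAt_ev A z).mul (hasFDerivAt_ev B z)).const_add c
  refine (this.congr_fderiv (ContinuousLinearMap.ext fun v => ?_)).congr_of_eventuallyEq
    (Filter.Eventually.of_forall hAB)
  simp [show ev A z = 0 from hzA, show ev B z = 0 from hzB]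

end Polynomials
end CanonicalCycles
end

noncomputable section

namespace CanonicalCycles

/-! ### Transport from punctured lines to fibres -/

/-- `W c` inverts the rectifying map on the fibre over `c`, for `c` outside of `E`. -/
structure Rectified (N : NormalForm) (E : Set ℂ) (W : ℂ → ℂ → ℂ × ℂ) : Prop where
  injective : ∀ c ∉ E, Function.Injective (N.puncture c)
  continuous_puncture : ∀ i, Continuous fun c => N.puncture c i
  left_inv : ∀ c ∉ E, ∀ z ∈ fiber N.poly c,
    (∀ i, ev N.first z ≠ N.puncture c i) ∧ W c (ev N.first z) = z
  right_inv : ∀ c ∉ E, ∀ t, (∀ i, t ≠ N.puncture c i) →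
    W c t ∈ fiber N.poly c ∧ ev N.first (W c t) = t
  continuousOn : ContinuousOn (fun v : ℂ × ℂ => W v.1 v.2)
    {v | v.1 ∉ E ∧ ∀ i, v.2 ≠ N.puncture v.1 i}

namespace Rectified

variable {N : NormalForm} {E : Set ℂ} {W : ℂ → ℂ → ℂ × ℂ}

theorem mem_compl_range {m : ℕ} {b : Fin m → ℂ} {t : ℂ} : t ∈ (Set.range b)ᶜ ↔ ∀ i, t ≠ b i := by
  simp [eq_comm]

/-- The homeomorphism of a punctured line with a fibre. -/
def homeomorph (R : Rectified N E W) {c : ℂ} (hc : c ∉ E) :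
    ((Set.range (N.puncture c))ᶜ : Set ℂ) ≃ₜ fiber N.poly c where
  toFun t := ⟨W c t, (R.right_inv c hc t (mem_compl_range.1 t.2)).1⟩
  invFun z := ⟨ev N.first z, mem_compl_range.2 (R.left_inv c hc z z.2).1⟩
  left_inv t := Subtype.ext (R.right_inv c hc t (mem_compl_range.1 t.2)).2
  right_inv z := Subtype.ext (R.left_inv c hc z z.2).2
  continuous_toFun := by
    refine Continuous.subtype_mk ?_ _
    exact R.continuousOn.comp_continuous (f := fun t : ((Set.range (N.puncture c))ᶜ : Set ℂ) =>
      (c, (t : ℂ))) (by fun_prop) fun t => ⟨hc, mem_compl_range.1 t.2⟩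
  continuous_invFun := ((continuous_ev _).comp continuous_subtype_val).subtype_mk _

/-- Needed for all `c ∉ E`, not only for generic `c`: the inclusion of `E` in the bifurcation set is
deduced from it. -/
theorem isPreconnected_fiber (R : Rectified N E W) {c : ℂ} (hc : c ∉ E) :
    IsPreconnected (fiber N.poly c) := by
  have h := (circlesGenerate_compl_range (R.injective c hc)).1.isConnected.isPreconnected
  have h2 : ContinuousOn (W c) (Set.range (N.puncture c))ᶜ :=
    R.continuousOn.comp (f := fun t => (c, t)) (Continuous.continuousOn (by fun_prop))
      fun t ht => ⟨hc, mem_compl_range.1 ht⟩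
  have h3 : W c '' (Set.range (N.puncture c))ᶜ = fiber N.poly c := by
    refine Set.Subset.antisymm (Set.image_subset_iff.2 fun t ht =>
      (R.right_inv c hc t (mem_compl_range.1 ht)).1) fun z hz => ?_
    exact ⟨_, mem_compl_range.2 (R.left_inv c hc z hz).1, (R.left_inv c hc z hz).2⟩
  exact h3 ▸ h.image _ h2

theorem bijOn (R : Rectified N E W) {c : ℂ} (hc : c ∉ E) :
    Set.BijOn N.rect (fiber N.poly c) (N.line c) := by
  refine ⟨fun z hz => ⟨hz, (R.left_inv c hc z hz).1⟩, fun z hz w hw h => ?_, ?_⟩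
  · rw [← (R.left_inv c hc z hz).2, ← (R.left_inv c hc w hw).2]
    exact congrArg (W c) (congrArg Prod.fst h)
  · rintro ⟨t, c'⟩ ⟨h1, h2⟩
    obtain rfl : c' = c := h1
    obtain ⟨h3, h4⟩ := R.right_inv c' hc t h2
    exact ⟨W c' t, h3, Prod.ext h4 h3⟩

/-- Injectivity of the rectifying map on the fibre forces the choice in `Function.invFunOn` to agree
with `W`; continuity of `delta` in `c` comes from this. -/
theorem rectInv_eq (R : Rectified N E W) {c : ℂ} (hc : c ∉ E) {t : ℂ}
    (ht : ∀ i, t ≠ N.puncture c i) : N.rectInv c (t, c) = W c t := by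
  have hb := R.bijOn hc
  obtain ⟨h3, h4⟩ := R.right_inv c hc t ht
  have := hb.injOn.leftInvOn_invFunOn h3
  rwa [show N.rect (W c t) = (t, c) from Prod.ext h4 h3] at this

/-- The homeomorphism of a punctured line with its copy at height `c`. -/
def lineHomeomorph (N : NormalForm) (c : ℂ) :
    ((Set.range (N.puncture c))ᶜ : Set ℂ) ≃ₜ N.line c where
  toFun t := ⟨(t, c), rfl, mem_compl_range.1 t.2⟩
  invFun w := ⟨w.1.1, mem_compl_range.2 w.2.2⟩
  left_inv t := rfl
  right_inv w := Subtype.ext (Prod.ext rfl w.2.1.symm)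
  continuous_toFun := by fun_prop
  continuous_invFun := by fun_prop

theorem exists_admissible (R : Rectified N E W) (hE : E ⊆ bifurcationSet N.poly) :
    ∃ ρ, N.Admissible ρ := by
  -- A product of factors at most `1` is bounded by each factor, and the half makes the inequality
  -- strict. The product is continuous in `c` and equals `1` when there is no other puncture.
  refine ⟨fun i c => (1 / 2) * ∏ j ∈ Finset.univ.erase i,
    min 1 (dist (N.puncture c i) (N.puncture c j)), fun i => ⟨?_, fun c hc => ?_⟩⟩
  · have := R.continuous_puncture
    refine Continuous.continuousOn ?_
    fun_prop
  · have hinj := R.injective c (fun h => hc (hE h))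
    have hpos : ∀ j ∈ Finset.univ.erase i, 0 < min 1 (dist (N.puncture c i) (N.puncture c j)) := by
      intro j hj
      exact lt_min one_pos (dist_pos.2 fun h => (Finset.mem_erase.1 hj).1 (hinj h).symm)
    have hp := Finset.prod_pos hpos
    refine ⟨by positivity, fun j hj => ?_⟩
    have hj' : j ∈ Finset.univ.erase i := Finset.mem_erase.2 ⟨hj, Finset.mem_univ _⟩
    have hle : ∏ j ∈ Finset.univ.erase i, min 1 (dist (N.puncture c i) (N.puncture c j)) ≤
        dist (N.puncture c i) (N.puncture c j) := by
      rw [← Finset.mul_prod_erase _ _ hj']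
      refine (mul_le_of_le_one_right (hpos j hj').le ?_).trans (min_le_right _ _)
      exact Finset.prod_le_one (fun k hk => (hpos k (Finset.mem_of_mem_erase hk)).le)
        fun k _ => min_le_left _ _
    linarith

theorem alpha_fst_ne {ρ : Fin N.rank → ℂ → ℝ} (hρ : N.Admissible ρ) {c : ℂ}
    (hc : c ∈ genericValues N.poly) (i j : Fin N.rank) (s : unitInterval) :
    (N.alpha ρ i c s).1 ≠ N.puncture c j :=
  mem_compl_range.1 (circlePath (((hρ i).2 c hc).1)
    (circle_subset_compl_range (b := N.puncture c) (ρ := fun i => ρ i c)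
      (fun i => ((hρ i).2 c hc).2) i) s).2 j

theorem continuousOn_alpha (R : Rectified N E W) {ρ : Fin N.rank → ℂ → ℝ} (hρ : N.Admissible ρ)
    (i : Fin N.rank) : ContinuousOn (fun v : ℂ × unitInterval => N.alpha ρ i v.1 v.2)
      (genericValues N.poly ×ˢ Set.univ) := by
  have h1 : ContinuousOn (fun v : ℂ × unitInterval => ((ρ i v.1 : ℝ) : ℂ))
      (genericValues N.poly ×ˢ Set.univ) :=
    Complex.continuous_ofReal.comp_continuousOn
      ((hρ i).1.comp continuousOn_fst fun v hv => hv.1)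
  have h2 : Continuous fun v : ℂ × unitInterval => N.puncture v.1 i :=
    (R.continuous_puncture i).comp continuous_fst
  refine ContinuousOn.prodMk (h2.continuousOn.add (h1.mul ?_)) continuousOn_fst
  exact Continuous.continuousOn (by fun_prop)

theorem isGlobalGenerators_alpha (R : Rectified N E W) (hE : E ⊆ bifurcationSet N.poly)
    {ρ : Fin N.rank → ℂ → ℝ} (hρ : N.Admissible ρ) :
    IsGlobalGenerators (genericValues N.poly) N.line (N.alpha ρ) := by
  have key := fun c (hc : c ∈ genericValues N.poly) =>
    cycles_of_homeomorph (R.injective c fun h => hc (hE h)) (fun i => ((hρ i).2 c hc).1)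
      (fun i => ((hρ i).2 c hc).2) (lineHomeomorph N c) (fun i s => N.alpha ρ i c s)
      (fun i s => rfl)
  exact ⟨fun c hc => (key c hc).1, R.continuousOn_alpha hρ, fun c hc => (key c hc).2⟩

theorem delta_eq (R : Rectified N E W) (hE : E ⊆ bifurcationSet N.poly)
    {ρ : Fin N.rank → ℂ → ℝ} (hρ : N.Admissible ρ) {c : ℂ} (hc : c ∈ genericValues N.poly)
    (i : Fin N.rank) (s : unitInterval) : N.delta ρ i c s = W c (N.alpha ρ i c s).1 :=
  R.rectInv_eq (fun h => hc (hE h)) fun j => alpha_fst_ne hρ hc i j s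

theorem continuousOn_delta (R : Rectified N E W) (hE : E ⊆ bifurcationSet N.poly)
    {ρ : Fin N.rank → ℂ → ℝ} (hρ : N.Admissible ρ) (i : Fin N.rank) :
    ContinuousOn (fun v : ℂ × unitInterval => N.delta ρ i v.1 v.2) (genericValues N.poly ×ˢ Set.univ) := by
  have h := R.continuousOn.comp (f := fun v : ℂ × unitInterval => (v.1, (N.alpha ρ i v.1 v.2).1))
    (continuousOn_fst.prodMk (continuous_fst.comp_continuousOn (R.continuousOn_alpha hρ i)))
    (fun v hv => ⟨fun h => hv.1 (hE h), fun j => alpha_fst_ne hρ hv.1 i j v.2⟩)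
  exact h.congr fun v hv => R.delta_eq hE hρ hv.1 i v.2

theorem isGlobalGenerators_delta (R : Rectified N E W) (hE : E ⊆ bifurcationSet N.poly)
    {ρ : Fin N.rank → ℂ → ℝ} (hρ : N.Admissible ρ) :
    IsGlobalGenerators (genericValues N.poly) (fiber N.poly) (N.delta ρ) := by
  have key := fun c (hc : c ∈ genericValues N.poly) =>
    cycles_of_homeomorph (R.injective c fun h => hc (hE h)) (fun i => ((hρ i).2 c hc).1)
      (fun i => ((hρ i).2 c hc).2) (R.homeomorph fun h => hc (hE h))
      (fun i s => N.delta ρ i c s) (fun i s => R.delta_eq hE hρ hc i s)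
  exact ⟨fun c hc => (key c hc).1, R.continuousOn_delta hE hρ, fun c hc => (key c hc).2⟩

/-- A homeomorphism of the plane restricts to fibres of conjugate polynomials. -/
def fiberHomeomorph {K H : Poly2} {ψ : ℂ × ℂ ≃ ℂ × ℂ} {σ : ℂ ≃ ℂ} (hψ : Continuous ψ)
    (hψ' : Continuous ψ.symm) (h : ∀ z, ev K z = σ (ev H (ψ.symm z))) (c : ℂ) :
    fiber K (σ c) ≃ₜ fiber H c where
  toFun z := ⟨ψ.symm z, σ.injective ((h z).symm.trans z.2)⟩
  invFun w := ⟨ψ w, by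
    change ev K (ψ w) = σ c
    rw [h, ψ.symm_apply_apply, show ev H w = c from w.2]⟩
  left_inv z := Subtype.ext (ψ.apply_symm_apply z)
  right_inv w := Subtype.ext (ψ.symm_apply_apply w)
  continuous_toFun := by fun_prop
  continuous_invFun := by fun_prop

theorem isGlobalGenerators_gamma (R : Rectified N E W) (hE : E ⊆ bifurcationSet N.poly)
    {ρ : Fin N.rank → ℂ → ℝ} (hρ : N.Admissible ρ) {H : Poly2} {ψ : ℂ × ℂ ≃ ℂ × ℂ} {σ : ℂ ≃ ℂ}
    (hψ : IsPolyAut2 ψ) (hσ : IsPolyAut1 σ) (h : ∀ z, ev N.poly z = σ (ev H (ψ.symm z))) :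
    IsGlobalGenerators (genericValues H) (fiber H) (N.gamma ψ σ ρ) := by
  have cψ : Continuous ψ := (hψ.1.contDiff (n := 0)).continuous
  have cψ' : Continuous ψ.symm := (hψ.2.contDiff (n := 0)).continuous
  have cσ : Continuous σ := (contDiff_of_eval hσ.1 (n := 0)).continuous
  have hg := fun c (hc : c ∈ genericValues H) => map_mem_genericValues hψ hσ h hc
  have key := fun c (hc : c ∈ genericValues H) =>
    cycles_of_homeomorph (R.injective (σ c) fun h => hg c hc (hE h))
      (fun i => ((hρ i).2 (σ c) (hg c hc)).1) (fun i => ((hρ i).2 (σ c) (hg c hc)).2)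
      ((R.homeomorph fun h => hg c hc (hE h)).trans (fiberHomeomorph cψ cψ' h c))
      (fun i s => N.gamma ψ σ ρ i c s)
      (fun i s => congrArg ψ.symm (R.delta_eq hE hρ (hg c hc) i s))
  refine ⟨fun c hc => (key c hc).1, fun i => ?_, fun c hc => (key c hc).2⟩
  exact cψ'.comp_continuousOn ((R.continuousOn_delta hE hρ i).comp
    (f := fun v : ℂ × unitInterval => (σ v.1, v.2)) (Continuous.continuousOn (by fun_prop))
    fun v hv => ⟨hg v.1 hv.1, trivial⟩)

end Rectified
end CanonicalCycles
end

noncomputable section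

namespace CanonicalCycles

/-! ### The first and second families -/

theorem ev_aeval (P : Polynomial ℂ) (z : ℂ × ℂ) :
    ev (Polynomial.aeval (MvPolynomial.X 0 : Poly2) P) z = P.eval z.1 := by
  induction P using Polynomial.induction_on' with
  | add p q hp hq => simp_all [ev]
  | monomial m a => simp [ev, Polynomial.aeval_monomial, MvPolynomial.algebraMap_eq]

/-- At a point of the fibre off `{A = 0}` the cofactor must vanish, so both factors have zeros. -/
theorem mem_bifurcationSet_of_dvd {H A : Poly2} {c : ℂ} (hAH : A ∣ H - MvPolynomial.C c)
    (hA : ∃ z, ev A z = 0) (hB : ∃ z, ev H z = c ∧ ev A z ≠ 0) {E : Set ℂ} (hE : E.Finite)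
    (hconn : ∀ c' ∉ E, IsPreconnected (fiber H c')) : c ∈ bifurcationSet H := by
  obtain ⟨B, h⟩ := hAH
  have h' : ∀ z, ev H z = c + ev A z * ev B z := fun z => by
    have := congrArg (fun K => ev K z) h
    simp only [ev, map_sub, map_mul, MvPolynomial.eval_C] at this ⊢
    linear_combination this
  refine mem_bifurcationSet_of_factor h' hA ?_ hE hconn
  obtain ⟨z, hz, hz'⟩ := hB
  refine ⟨z, ?_⟩
  have := h' z
  rw [hz] at this
  simpa [hz'] using this

/-- For a polynomial constant on the line `x = 0`, this is divisibility of its difference from that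
constant by `x`. -/
theorem exists_ev_eq_add_fst_mul (H : Poly2) :
    ∃ B : Poly2, ∀ z, ev H z = ev H (0, z.2) + z.1 * ev B z := by
  induction H using MvPolynomial.induction_on with
  | C a => exact ⟨0, fun z => by simp [ev]⟩
  | add p q hp hq =>
    obtain ⟨A, hA⟩ := hp
    obtain ⟨B, hB⟩ := hq
    refine ⟨A + B, fun z => ?_⟩
    have h1 := hA z
    have h2 := hB z
    simp only [ev, map_add] at h1 h2 ⊢
    linear_combination h1 + h2
  | mul_X p i hp =>
    obtain ⟨A, hA⟩ := hp
    fin_cases i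
    · exact ⟨p, fun z => by simp [ev, mul_comm]⟩
    · refine ⟨A * MvPolynomial.X 1, fun z => ?_⟩
      have h1 := hA z
      simp [ev] at h1 ⊢
      linear_combination z.2 * h1

theorem zpow_mul_zpow_pow {t u : ℂ} (ht : t ≠ 0) (hu : u ≠ 0) (a b c d : ℤ) (m n : ℕ) :
    (t ^ a * u ^ b) ^ m * (t ^ c * u ^ d) ^ n = t ^ (a * m + c * n) * u ^ (b * m + d * n) := by
  simp only [zpow_add₀ ht, zpow_add₀ hu, mul_pow, zpow_mul, zpow_natCast]
  ring

theorem pow_mul_pow_zpow {x s : ℂ} (hx : x ≠ 0) (hs : s ≠ 0) (a b : ℤ) (i j m n : ℕ) :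
    (x ^ i * s ^ j) ^ a * (x ^ m * s ^ n) ^ b = x ^ (i * a + m * b) * s ^ (j * a + n * b) := by
  simp only [zpow_add₀ hx, zpow_add₀ hs, mul_zpow, zpow_mul, zpow_natCast]
  ring

namespace ParamS

variable {n : ℕ} (D : ParamS n)

theorem ev_S (z : ℂ × ℂ) : ev D.S z = z.1 ^ D.k * z.2 + D.P.eval z.1 := by
  have := ev_aeval D.P z
  simp only [ev] at this
  simp [ev, S, this]

theorem ev_G (z : ℂ × ℂ) : ev D.G z = z.1 ^ D.q₁ * ev D.S z ^ D.q := by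
  simp [ev, G]

/-- The polynomial `∏ (β i - t) ^ a i` in `t`. -/
def Q (t : ℂ) : ℂ := ∏ i, (D.β i - t) ^ D.a i

theorem Q_ne_zero_iff {t : ℂ} : D.Q t ≠ 0 ↔ ∀ i, t ≠ D.β i := by
  rw [Q, Finset.prod_ne_zero_iff]
  refine ⟨fun h i hi => ?_, fun h i _ => pow_ne_zero _ (sub_ne_zero.2 (h i).symm)⟩
  exact h i (Finset.mem_univ i) (by rw [hi, sub_self, zero_pow (D.a_pos i).ne'])

theorem ev_T (z : ℂ × ℂ) :
    ev D.T z = z.1 ^ D.p₁ * ev D.S z ^ D.p * D.Q (ev D.G z) := by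
  simp [ev, T, Q]

theorem p_pos : 0 < D.p := Nat.zero_lt_of_lt D.p₁_lt

theorem q_pos : 0 < D.q := Nat.zero_lt_of_lt D.q₁_lt

/-- The polynomial `κ G + T`, which is the normal form of the first family for `κ = 1`, and of
the second family for `κ = 0`. -/
def H (κ : ℂ) : Poly2 := MvPolynomial.C κ * D.G + D.T

theorem ev_H (κ : ℂ) (z : ℂ × ℂ) : ev (D.H κ) z =
    κ * ev D.G z + z.1 ^ D.p₁ * ev D.S z ^ D.p * D.Q (ev D.G z) := by
  have := D.ev_T z
  simp only [ev] at this
  simp [ev, H, this]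

/-- The determinant of the exponents. -/
def e : ℤ := D.p * D.q₁ - D.q * D.p₁

/-- A determinant `±1` is its own inverse, so the inverse of the exponent matrix is `e` times its
adjugate. Its entries are the exponents in `liftX` and `liftS`. -/
theorem e_mul_e : D.e * D.e = 1 := by
  rcases D.det with h | h <;> simp [e, h]

/-- The `x`-coordinate of the point with `x ^ q₁ S ^ q = t` and `x ^ p₁ S ^ p = u`. -/
def liftX (t u : ℂ) : ℂ := t ^ (D.p * D.e) * u ^ (-(D.q * D.e))

/-- The value of `S` at the point with `x ^ q₁ S ^ q = t` and `x ^ p₁ S ^ p = u`. -/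
def liftS (t u : ℂ) : ℂ := t ^ (-(D.p₁ * D.e)) * u ^ (D.q₁ * D.e)

/-- The point with `x ^ q₁ S ^ q = t` and `x ^ p₁ S ^ p = u`. -/
def lift (t u : ℂ) : ℂ × ℂ :=
  (D.liftX t u, (D.liftS t u - D.P.eval (D.liftX t u)) / D.liftX t u ^ D.k)

section Lift

variable {t u : ℂ} (ht : t ≠ 0) (hu : u ≠ 0)

include ht hu

theorem liftX_ne_zero : D.liftX t u ≠ 0 := mul_ne_zero (zpow_ne_zero _ ht) (zpow_ne_zero _ hu)

theorem ev_S_lift : ev D.S (D.lift t u) = D.liftS t u := by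
  have := pow_ne_zero D.k (D.liftX_ne_zero ht hu)
  rw [ev_S]
  simp only [lift]
  field_simp
  ring

theorem ev_S_lift_ne_zero : ev D.S (D.lift t u) ≠ 0 := by
  rw [D.ev_S_lift ht hu]
  exact mul_ne_zero (zpow_ne_zero _ ht) (zpow_ne_zero _ hu)

theorem ev_G_lift : ev D.G (D.lift t u) = t := by
  rw [ev_G, D.ev_S_lift ht hu]
  change (D.liftX t u) ^ D.q₁ * _ = _
  rw [liftX, liftS, zpow_mul_zpow_pow ht hu]
  have h1 : (D.p * D.e * D.q₁ + -(D.p₁ * D.e) * D.q : ℤ) = 1 := by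
    rw [← D.e_mul_e]
    nth_rw 4 [e]
    ring
  have h2 : (-(D.q * D.e) * D.q₁ + D.q₁ * D.e * D.q : ℤ) = 0 := by ring
  rw [h1, h2]
  simp

theorem monomial_lift : (D.lift t u).1 ^ D.p₁ * ev D.S (D.lift t u) ^ D.p = u := by
  rw [D.ev_S_lift ht hu]
  change (D.liftX t u) ^ D.p₁ * _ = _
  rw [liftX, liftS, zpow_mul_zpow_pow ht hu]
  have h1 : (D.p * D.e * D.p₁ + -(D.p₁ * D.e) * D.p : ℤ) = 0 := by ring
  have h2 : (-(D.q * D.e) * D.p₁ + D.q₁ * D.e * D.p : ℤ) = 1 := by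
    rw [← D.e_mul_e]
    nth_rw 4 [e]
    ring
  rw [h1, h2]
  simp

end Lift

/-- Together with `ev_G_lift` and `monomial_lift`: a unimodular monomial map is invertible on pairs
of nonzero numbers, and `S` determines `y` when `x ≠ 0`. -/
theorem lift_eq {z : ℂ × ℂ} (hx : z.1 ≠ 0) (hs : ev D.S z ≠ 0) :
    D.lift (ev D.G z) (z.1 ^ D.p₁ * ev D.S z ^ D.p) = z := by
  have hX : D.liftX (ev D.G z) (z.1 ^ D.p₁ * ev D.S z ^ D.p) = z.1 := by
    rw [ev_G, liftX, pow_mul_pow_zpow hx hs]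
    have h1 : (D.q₁ * (D.p * D.e) + D.p₁ * -(D.q * D.e) : ℤ) = 1 := by
      rw [← D.e_mul_e]
      nth_rw 4 [e]
      ring
    have h2 : (D.q * (D.p * D.e) + D.p * -(D.q * D.e) : ℤ) = 0 := by ring
    rw [h1, h2]
    simp
  have hS : D.liftS (ev D.G z) (z.1 ^ D.p₁ * ev D.S z ^ D.p) = ev D.S z := by
    rw [ev_G, liftS, pow_mul_pow_zpow hx hs]
    have h1 : (D.q₁ * -(D.p₁ * D.e) + D.p₁ * (D.q₁ * D.e) : ℤ) = 0 := by ring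
    have h2 : (D.q * -(D.p₁ * D.e) + D.p * (D.q₁ * D.e) : ℤ) = 1 := by
      rw [← D.e_mul_e]
      nth_rw 4 [e]
      ring
    rw [h1, h2]
    simp
  refine Prod.ext hX ?_
  simp only [lift, hX, hS]
  rw [ev_S, add_sub_cancel_right]
  field_simp

theorem continuousOn_lift :
    ContinuousOn (fun v : ℂ × ℂ => D.lift v.1 v.2) {v | v.1 ≠ 0 ∧ v.2 ≠ 0} := by
  have h : ∀ a b : ℤ, ContinuousOn (fun v : ℂ × ℂ => v.1 ^ a * v.2 ^ b)
      {v | v.1 ≠ 0 ∧ v.2 ≠ 0} := fun a b =>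
    (continuousOn_fst.zpow₀ a fun v hv => Or.inl hv.1).mul
      (continuousOn_snd.zpow₀ b fun v hv => Or.inl hv.2)
  have hX := h (D.p * D.e) (-(D.q * D.e))
  have hS := h (-(D.p₁ * D.e)) (D.q₁ * D.e)
  refine hX.prodMk ((hS.sub (D.P.continuous.comp_continuousOn hX)).div (hX.pow _) fun v hv => ?_)
  exact pow_ne_zero _ (D.liftX_ne_zero hv.1 hv.2)

/-- The point of the fibre `{κ G + T = c}` with `G = t`. -/
def point (κ c t : ℂ) : ℂ × ℂ := D.lift t ((c - κ * t) / D.Q t)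

section Point

variable {κ c t : ℂ} (ht : t ≠ 0) (hQ : ∀ i, t ≠ D.β i) (hc : c - κ * t ≠ 0)

include ht hQ hc

omit ht in
theorem monomial_ne_zero : (c - κ * t) / D.Q t ≠ 0 := div_ne_zero hc (D.Q_ne_zero_iff.2 hQ)

theorem ev_G_point : ev D.G (D.point κ c t) = t := D.ev_G_lift ht (D.monomial_ne_zero hQ hc)

theorem ev_H_point : ev (D.H κ) (D.point κ c t) = c := by
  have hQ' := D.Q_ne_zero_iff.2 hQ
  rw [ev_H, D.ev_G_point ht hQ hc, point, D.monomial_lift ht (D.monomial_ne_zero hQ hc)]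
  field_simp
  ring

theorem fst_point_ne_zero : (D.point κ c t).1 ≠ 0 :=
  D.liftX_ne_zero ht (D.monomial_ne_zero hQ hc)

theorem ev_S_point_ne_zero : ev D.S (D.point κ c t) ≠ 0 :=
  D.ev_S_lift_ne_zero ht (D.monomial_ne_zero hQ hc)

end Point

theorem continuous_Q : Continuous D.Q := by
  unfold Q
  fun_prop

theorem continuousOn_point (κ : ℂ) : ContinuousOn (fun v : ℂ × ℂ => D.point κ v.1 v.2)
    {v | v.2 ≠ 0 ∧ (∀ i, v.2 ≠ D.β i) ∧ v.1 - κ * v.2 ≠ 0} := by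
  refine D.continuousOn_lift.comp (f := fun v : ℂ × ℂ => (v.2, (v.1 - κ * v.2) / D.Q v.2)) ?_
    fun v hv => ⟨hv.1, D.monomial_ne_zero hv.2.1 hv.2.2⟩
  refine continuousOn_snd.prodMk (ContinuousOn.div (by fun_prop)
    (D.continuous_Q.comp continuous_snd).continuousOn fun v hv => D.Q_ne_zero_iff.2 hv.2.1)

/-- The values of `κ G + T` which are taken where `x S ∏ (β i - G)` vanishes. -/
def exc (κ : ℂ) : Set ℂ := {0, ev (D.H κ) (0, 0)} ∪ Set.range fun i => κ * D.β i

theorem finite_exc (κ : ℂ) : (D.exc κ).Finite :=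
  (Set.toFinite _).union (Set.finite_range _)

theorem ev_S_zero (y : ℂ) : ev D.S (0, y) = D.P.eval 0 := by
  have := D.k_pos
  rw [ev_S]
  simp [Nat.pos_iff_ne_zero.1 this]

theorem ev_H_zero (κ y : ℂ) : ev (D.H κ) (0, y) = ev (D.H κ) (0, 0) := by
  simp only [ev_H, ev_G, ev_S_zero]

theorem ev_H_of_S {κ : ℂ} {z : ℂ × ℂ} (h : ev D.S z = 0) : ev (D.H κ) z = 0 := by
  rw [ev_H, ev_G, h, zero_pow D.p_pos.ne', zero_pow D.q_pos.ne']
  ring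

/-- On such a fibre `x`, `S` and all `β i - G` are nonzero, because `κ G + T` takes only values in
`exc` where one of them vanishes. The equation of the fibre can then be solved for `x^p₁ S^p`. -/
theorem of_mem_fiber {κ c : ℂ} (hc : c ∉ D.exc κ) {z : ℂ × ℂ} (hz : ev (D.H κ) z = c) :
    ev D.G z ≠ 0 ∧ (∀ i, ev D.G z ≠ D.β i) ∧ c - κ * ev D.G z ≠ 0 ∧
      D.point κ c (ev D.G z) = z := by
  have hx : z.1 ≠ 0 := fun h => hc <| Or.inl <| Or.inr <| by
    rw [← hz, ← D.ev_H_zero κ z.2, ← h]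
    rfl
  have hs : ev D.S z ≠ 0 := fun h => hc <| Or.inl <| Or.inl <| hz.symm.trans (D.ev_H_of_S h)
  have hQ : ∀ i, ev D.G z ≠ D.β i := fun i h => hc <| Or.inr ⟨i, by
    have h0 : D.Q (ev D.G z) = 0 := by
      by_contra h0
      exact D.Q_ne_zero_iff.1 h0 i h
    rw [ev_H, h0, h] at hz
    simpa using hz⟩
  have hQ' := D.Q_ne_zero_iff.2 hQ
  have hm : c - κ * ev D.G z = z.1 ^ D.p₁ * ev D.S z ^ D.p * D.Q (ev D.G z) := by
    rw [← hz, ev_H]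
    ring
  refine ⟨?_, hQ, ?_, ?_⟩
  · rw [ev_G]
    exact mul_ne_zero (pow_ne_zero _ hx) (pow_ne_zero _ hs)
  · rw [hm]
    exact mul_ne_zero (mul_ne_zero (pow_ne_zero _ hx) (pow_ne_zero _ hs)) hQ'
  · rw [point, hm, mul_div_cancel_right₀ _ hQ', D.lift_eq hx hs]

theorem exists_ne (c : ℂ) : ∃ t : ℂ, t ≠ 0 ∧ (∀ i, t ≠ D.β i) ∧ t ≠ c := by
  have hf : (({0, c} : Set ℂ) ∪ Set.range D.β).Finite :=
    (Set.toFinite _).union (Set.finite_range _)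
  obtain ⟨t, ht⟩ := hf.infinite_compl.nonempty
  exact ⟨t, fun h => ht (Or.inl (Or.inl h)), fun i h => ht (Or.inr ⟨i, h.symm⟩),
    fun h => ht (Or.inl (Or.inr h))⟩

theorem ev_S_one : ev D.S (1, -D.P.eval 1) = 0 := by
  rw [ev_S]
  simp

theorem sub_C_beta_dvd_T (i : Fin n) : (MvPolynomial.C (D.β i) - D.G) ∣ D.T :=
  Dvd.dvd.mul_left ((dvd_pow_self _ (D.a_pos i).ne').trans
    (Finset.dvd_prod_of_mem (fun i => (MvPolynomial.C (D.β i) - D.G) ^ D.a i)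
      (Finset.mem_univ i))) _

theorem ev_G_lift_one (i : Fin n) : ev D.G (D.lift (D.β i) 1) = D.β i :=
  D.ev_G_lift (D.β_ne i) one_ne_zero

theorem ev_H_lift_one (κ : ℂ) (i : Fin n) : ev (D.H κ) (D.lift (D.β i) 1) = κ * D.β i := by
  have h0 : D.Q (D.β i) = 0 := by
    by_contra h0
    exact D.Q_ne_zero_iff.1 h0 i rfl
  rw [ev_H, D.ev_G_lift_one, h0, mul_zero, add_zero]

section Bifurcation

variable {κ : ℂ} (hκ : κ = 0 ∨ κ = 1)
  (hconn : ∀ c ∉ D.exc κ, IsPreconnected (fiber (D.H κ) c))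

include hκ hconn

/-- The factor is `x`. A point of the same fibre with `x ≠ 0` is found on `S = 0` if the value is
`0`, and among the explicit points `D.point κ c t` otherwise. -/
theorem value_zero_mem_bifurcationSet : ev (D.H κ) (0, 0) ∈ bifurcationSet (D.H κ) := by
  obtain ⟨B, hB⟩ := exists_ev_eq_add_fst_mul (D.H κ)
  have hdvd : MvPolynomial.X 0 ∣ D.H κ - MvPolynomial.C (ev (D.H κ) (0, 0)) := by
    refine ⟨B, MvPolynomial.funext fun v => ?_⟩
    have := hB (v 0, v 1)
    have hv : ![v 0, v 1] = v := by
      ext i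
      fin_cases i <;> rfl
    rw [D.ev_H_zero] at this
    simp only [ev, hv] at this ⊢
    simp [this]
  refine mem_bifurcationSet_of_dvd hdvd ⟨(0, 0), by simp [ev]⟩ ?_ (D.finite_exc κ) hconn
  by_cases h0 : ev (D.H κ) (0, 0) = 0
  · exact ⟨(1, -D.P.eval 1), by rw [h0, D.ev_H_of_S D.ev_S_one], by simp [ev]⟩
  · obtain ⟨t, ht, hQ, hc⟩ := D.exists_ne (ev (D.H κ) (0, 0))
    have hc' : ev (D.H κ) (0, 0) - κ * t ≠ 0 := by
      rcases hκ with rfl | rfl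
      · simpa using h0
      · rw [one_mul]
        exact sub_ne_zero.2 hc.symm
    exact ⟨_, D.ev_H_point ht hQ hc', by simpa [ev] using D.fst_point_ne_zero ht hQ hc'⟩

/-- Unless the line `x = 0` already has value `0`, the factor is `S`, and one needs a point of the
zero fibre with `S ≠ 0`. -/
theorem zero_mem_bifurcationSet (hD : κ = 0 → n = 0 → D.p₁ = 0 → D.P.eval 0 = 0) :
    0 ∈ bifurcationSet (D.H κ) := by
  by_cases h0 : ev (D.H κ) (0, 0) = 0
  · exact h0 ▸ D.value_zero_mem_bifurcationSet hκ hconn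
  have hdvd : D.S ∣ D.H κ - MvPolynomial.C 0 := by
    rw [map_zero, sub_zero]
    exact dvd_add (Dvd.dvd.mul_left (Dvd.dvd.mul_left (dvd_pow_self _ D.q_pos.ne') _) _)
      (Dvd.dvd.mul_right (Dvd.dvd.mul_left (dvd_pow_self _ D.p_pos.ne') _) _)
  refine mem_bifurcationSet_of_dvd hdvd ⟨_, D.ev_S_one⟩ ?_ (D.finite_exc κ) hconn
  rcases hκ with rfl | rfl
  -- For `κ = 0` the curve `G = β i` supplies the point. If there is no `β i`, the value on `x = 0`
  -- is `0`: because of the factor `x^p₁` if `p₁ > 0`, and by the normalization `P(0) = 0` if `p₁ =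
  -- 0`.
  · obtain rfl | hn := Nat.eq_zero_or_pos n
    · refine absurd ?_ h0
      rw [ev_H, ev_S_zero]
      by_cases hp : D.p₁ = 0
      · rw [hD rfl rfl hp, zero_pow D.p_pos.ne']
        ring
      · simp [hp]
    · exact ⟨_, (D.ev_H_lift_one 0 ⟨0, hn⟩).trans (zero_mul _),
        D.ev_S_lift_ne_zero (D.β_ne _) one_ne_zero⟩
  · obtain ⟨t, ht, hQ, -⟩ := D.exists_ne 0
    have hc' : (0 : ℂ) - 1 * t ≠ 0 := by simpa using ht
    exact ⟨_, D.ev_H_point ht hQ hc', D.ev_S_point_ne_zero ht hQ hc'⟩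

theorem exc_subset (hD : κ = 0 → n = 0 → D.p₁ = 0 → D.P.eval 0 = 0) :
    D.exc κ ⊆ bifurcationSet (D.H κ) := by
  rintro c ((rfl | rfl) | ⟨i, rfl⟩)
  · exact D.zero_mem_bifurcationSet hκ hconn hD
  · exact D.value_zero_mem_bifurcationSet hκ hconn
  rcases id hκ with rfl | rfl
  · simpa using D.zero_mem_bifurcationSet hκ hconn hD
  -- `𝓗 - β i = T - (β i - G)`, and `T` contains the factor `β i - G`.
  · have hdvd : (MvPolynomial.C (D.β i) - D.G) ∣ D.H 1 - MvPolynomial.C (1 * D.β i) := by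
      have : D.H 1 - MvPolynomial.C (1 * D.β i) = D.T - (MvPolynomial.C (D.β i) - D.G) := by
        rw [H, map_one, one_mul, one_mul]
        ring
      rw [this]
      exact dvd_sub (D.sub_C_beta_dvd_T i) dvd_rfl
    have hev : ∀ z, ev (MvPolynomial.C (D.β i) - D.G) z = D.β i - ev D.G z := fun z => by
      simp [ev]
    refine mem_bifurcationSet_of_dvd hdvd ⟨D.lift (D.β i) 1, ?_⟩ ?_ (D.finite_exc 1)
      hconn
    · rw [hev, D.ev_G_lift_one, sub_self]
    · obtain ⟨t, ht, hQ, -⟩ := D.exists_ne 0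
      have hc' : 1 * D.β i - 1 * t ≠ 0 := by
        simpa [sub_eq_zero] using (hQ i).symm
      refine ⟨_, D.ev_H_point ht hQ hc', ?_⟩
      rw [hev, D.ev_G_point ht hQ hc']
      exact sub_ne_zero.2 (hQ i).symm

end Bifurcation

end ParamS
end CanonicalCycles
end

noncomputable section

namespace CanonicalCycles

/-! ### Rectification of the first and second families -/

namespace ParamS

variable {n : ℕ} (D : ParamS n)

theorem H_one : D.H 1 = D.G + D.T := by simp [H]

theorem H_zero : D.H 0 = D.T := by simp [H]

/-- For `κ = 1` the condition `c - κ t ≠ 0` is the moving puncture `t = c`. It collides with another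
puncture only for `c = 0` or `c = β i`, and these values belong to `exc`. -/
theorem rectified_one (hn : 1 ≤ n) : Rectified (.one n hn D) (D.exc 1) (D.point 1) := by
  have hp : ∀ c t : ℂ, (∀ i, t ≠ (NormalForm.one n hn D).puncture c i) ↔
      t ≠ 0 ∧ (∀ i, t ≠ D.β i) ∧ c - 1 * t ≠ 0 := fun c t => by
    rw [one_mul, sub_ne_zero, ne_comm (a := c)]
    change (∀ i : Fin (n + 2), t ≠ (Fin.cons 0 (Fin.snoc D.β c : Fin (n + 1) → ℂ) :
      Fin (n + 2) → ℂ) i) ↔ _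
    rw [Fin.forall_fin_succ, Fin.forall_fin_succ']
    simp
  have hH : (NormalForm.one n hn D).poly = D.H 1 := D.H_one.symm
  refine ⟨fun c hc => ?_, fun i => ?_, fun c hc z hz => ?_, fun c hc t ht => ?_, ?_⟩
  · change Function.Injective (Fin.cons 0 (Fin.snoc D.β c : Fin (n + 1) → ℂ) : Fin (n + 2) → ℂ)
    have h0 : c ≠ 0 := fun h => hc (Or.inl (Or.inl h))
    have h1 : c ∉ Set.range D.β := fun ⟨i, h⟩ => hc (Or.inr ⟨i, (one_mul _).trans h⟩)
    rw [Fin.cons_injective_iff]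
    refine ⟨?_, Fin.snoc_injective_iff.2 ⟨D.β_inj, h1⟩⟩
    rw [Fin.range_snoc]
    rintro (h | ⟨i, h⟩)
    · exact h0 h.symm
    · exact D.β_ne i h
  · change Continuous fun c => (Fin.cons 0 (Fin.snoc D.β c : Fin (n + 1) → ℂ) : Fin (n + 2) → ℂ) i
    refine Fin.cases continuous_const (fun i => ?_) i
    refine Fin.lastCases ?_ (fun i => ?_) i
    · simpa using continuous_id'
    · simpa using continuous_const
  · rw [hH] at hz
    obtain ⟨h1, h2, h3, h4⟩ := D.of_mem_fiber hc hz
    exact ⟨(hp _ _).2 ⟨h1, h2, h3⟩, h4⟩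
  · obtain ⟨h1, h2, h3⟩ := (hp _ _).1 ht
    rw [hH]
    exact ⟨D.ev_H_point h1 h2 h3, D.ev_G_point h1 h2 h3⟩
  · exact (D.continuousOn_point 1).mono fun v hv => (hp _ _).1 hv.2

/-- For `κ = 0` the condition `c - κ t ≠ 0` reads `c ≠ 0`, which holds outside `exc`; no puncture
depends on `c`. -/
theorem rectified_two (hD : n = 0 → D.p₁ = 0 → D.P.eval 0 = 0) :
    Rectified (.two n D hD) (D.exc 0) (D.point 0) := by
  have hp : ∀ c t : ℂ, (∀ i, t ≠ (NormalForm.two n D hD).puncture c i) ↔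
      t ≠ 0 ∧ ∀ i, t ≠ D.β i := fun c t => by
    change (∀ i : Fin (n + 1), t ≠ (Fin.cons 0 D.β : Fin (n + 1) → ℂ) i) ↔ _
    rw [Fin.forall_fin_succ]
    simp
  have h0 : ∀ c ∉ D.exc 0, ∀ t : ℂ, c - 0 * t ≠ 0 := fun c hc t h =>
    hc (Or.inl (Or.inl (by simpa using h)))
  have hH : (NormalForm.two n D hD).poly = D.H 0 := D.H_zero.symm
  refine ⟨fun c hc => ?_, fun i => continuous_const, fun c hc z hz => ?_, fun c hc t ht => ?_, ?_⟩
  · change Function.Injective (Fin.cons 0 D.β : Fin (n + 1) → ℂ)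
    rw [Fin.cons_injective_iff]
    exact ⟨fun ⟨i, h⟩ => D.β_ne i h, D.β_inj⟩
  · rw [hH] at hz
    obtain ⟨h1, h2, h3, h4⟩ := D.of_mem_fiber hc hz
    exact ⟨(hp _ _).2 ⟨h1, h2⟩, h4⟩
  · obtain ⟨h1, h2⟩ := (hp _ _).1 ht
    rw [hH]
    exact ⟨D.ev_H_point h1 h2 (h0 c hc t), D.ev_G_point h1 h2 (h0 c hc t)⟩
  · exact (D.continuousOn_point 0).mono fun v hv =>
      ⟨((hp _ _).1 hv.2).1, ((hp _ _).1 hv.2).2, h0 _ hv.1 _⟩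

theorem exc_subset_one (hn : 1 ≤ n) :
    D.exc 1 ⊆ bifurcationSet (NormalForm.one n hn D).poly := by
  have hH : (NormalForm.one n hn D).poly = D.H 1 := D.H_one.symm
  have hc := fun c (hc : c ∉ D.exc 1) => (D.rectified_one hn).isPreconnected_fiber hc
  rw [hH] at hc ⊢
  exact D.exc_subset (Or.inr rfl) hc fun h => absurd h one_ne_zero

theorem exc_subset_two (hD : n = 0 → D.p₁ = 0 → D.P.eval 0 = 0) :
    D.exc 0 ⊆ bifurcationSet (NormalForm.two n D hD).poly := by
  have hH : (NormalForm.two n D hD).poly = D.H 0 := D.H_zero.symm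
  have hc := fun c (hc : c ∉ D.exc 0) => (D.rectified_two hD).isPreconnected_fiber hc
  rw [hH] at hc ⊢
  exact D.exc_subset (Or.inl rfl) hc fun _ => hD

end ParamS

/-! ### The third family -/

namespace ParamH

variable {n : ℕ} (D : ParamH n)

/-- The polynomial `∏ (β i - t) ^ a i` in `t`. -/
def Q (t : ℂ) : ℂ := ∏ i, (D.β i - t) ^ D.a i

theorem Q_ne_zero_iff {t : ℂ} : D.Q t ≠ 0 ↔ ∀ i, t ≠ D.β i := by
  rw [Q, Finset.prod_ne_zero_iff]
  refine ⟨fun h i hi => ?_, fun h i _ => pow_ne_zero _ (sub_ne_zero.2 (h i).symm)⟩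
  exact h i (Finset.mem_univ i) (by rw [hi, sub_self, zero_pow (D.a_pos i).ne'])

theorem ev_poly (z : ℂ × ℂ) :
    ev (NormalForm.three n D).poly z = z.2 * D.Q z.1 + D.h.eval z.1 := by
  have := ev_aeval D.h z
  simp only [ev] at this
  simp [ev, NormalForm.poly, Q, this]

/-- The values of the polynomial on the lines `x = β i`. -/
def exc : Set ℂ := Set.range fun i => D.h.eval (D.β i)

/-- The point of the fibre over `c` with `x = t`. -/
def point (c t : ℂ) : ℂ × ℂ := (t, (c - D.h.eval t) / D.Q t)

theorem ev_point {c t : ℂ} (ht : ∀ i, t ≠ D.β i) :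
    ev (NormalForm.three n D).poly (D.point c t) = c := by
  have := D.Q_ne_zero_iff.2 ht
  rw [ev_poly]
  simp only [point]
  field_simp
  ring

/-- On the line `x = β i` the polynomial is constantly `h (β i)`, so fibres outside `exc` miss these
lines; elsewhere the equation is linear in `y` with nonzero coefficient. -/
theorem rectified : Rectified (.three n D) D.exc D.point := by
  have hfirst : ∀ z, ev (NormalForm.three n D).first z = z.1 := fun z => by
    simp [ev, NormalForm.first]
  refine ⟨fun c hc => D.β_inj, fun i => continuous_const, fun c hc z hz => ?_,
    fun c hc t ht => ⟨D.ev_point ht, hfirst _⟩, ?_⟩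
  · have hz' : z.2 * D.Q z.1 + D.h.eval z.1 = c := (D.ev_poly z).symm.trans hz
    have ht : ∀ i, z.1 ≠ D.β i := fun i h => hc ⟨i, by
      have h0 : D.Q (D.β i) = 0 := by
        by_contra h0
        exact D.Q_ne_zero_iff.1 h0 i rfl
      simpa [h, h0] using hz'⟩
    have hQ := D.Q_ne_zero_iff.2 ht
    rw [hfirst]
    refine ⟨ht, Prod.ext rfl ?_⟩
    simp only [point, ← hz', add_sub_cancel_right]
    field_simp
  · have hQ : Continuous D.Q := by
      unfold Q
      fun_prop
    have hh := D.h.continuous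
    exact continuousOn_snd.prodMk (ContinuousOn.div (by fun_prop)
      (hQ.comp continuous_snd).continuousOn fun v hv => D.Q_ne_zero_iff.2 hv.2)

/-- The linear factor `β i - x` divides both the product and `h(x) - h(β i)`. -/
theorem exc_subset : D.exc ⊆ bifurcationSet (NormalForm.three n D).poly := by
  rintro _ ⟨i, rfl⟩
  have hev : ∀ z, ev (MvPolynomial.C (D.β i) - MvPolynomial.X 0) z = D.β i - z.1 := fun z => by
    simp [ev]
  have hdvd : (MvPolynomial.C (D.β i) - MvPolynomial.X 0) ∣
      (NormalForm.three n D).poly - MvPolynomial.C (D.h.eval (D.β i)) := by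
    rw [NormalForm.poly, add_sub_assoc]
    refine dvd_add (Dvd.dvd.mul_left ((dvd_pow_self _ (D.a_pos i).ne').trans
      (Finset.dvd_prod_of_mem (fun i => (MvPolynomial.C (D.β i) - MvPolynomial.X 0) ^ D.a i)
        (Finset.mem_univ i))) _) ?_
    have h := map_dvd (Polynomial.aeval (MvPolynomial.X 0 : Poly2))
      (Polynomial.X_sub_C_dvd_sub_C_eval (a := D.β i) (p := D.h))
    rw [map_sub, map_sub, Polynomial.aeval_X, Polynomial.aeval_C, Polynomial.aeval_C] at h
    rw [← neg_sub]
    exact neg_dvd.2 h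
  have hf := (Set.finite_range D.β).infinite_compl.nonempty
  obtain ⟨t, ht⟩ := hf
  have ht' : ∀ i, t ≠ D.β i := fun i h => ht ⟨i, h.symm⟩
  refine mem_bifurcationSet_of_dvd hdvd ⟨(D.β i, 0), by simp [hev]⟩
    ⟨_, D.ev_point ht', ?_⟩ (Set.finite_range _ : D.exc.Finite)
    fun c hc => D.rectified.isPreconnected_fiber hc
  rw [hev]
  exact sub_ne_zero.2 (ht' i).symm

end ParamH

theorem NormalForm.exists_rectified (N : NormalForm) :
    ∃ E W, Rectified N E W ∧ E ⊆ bifurcationSet N.poly := by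
  cases N with
  | one n hn D => exact ⟨_, _, D.rectified_one hn, D.exc_subset_one hn⟩
  | two n D hD => exact ⟨_, _, D.rectified_two hD, D.exc_subset_two hD⟩
  | three n D => exact ⟨_, _, D.rectified, D.exc_subset⟩

end CanonicalCycles

end

theorem mainTheorem10 (N : CanonicalCycles.NormalForm) :
    (∀ c ∈ CanonicalCycles.genericValues N.poly,
      Set.BijOn N.rect (CanonicalCycles.fiber N.poly c) (N.line c)) ∧
    (∃ ρ : Fin N.rank → ℂ → ℝ, N.Admissible ρ) ∧
    ∀ ρ : Fin N.rank → ℂ → ℝ, N.Admissible ρ →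
      CanonicalCycles.IsGlobalGenerators (CanonicalCycles.genericValues N.poly)
        N.line (N.alpha ρ) ∧
      CanonicalCycles.IsGlobalGenerators (CanonicalCycles.genericValues N.poly)
        (CanonicalCycles.fiber N.poly) (N.delta ρ) ∧
      ∀ (H : CanonicalCycles.Poly2) (ψ : ℂ × ℂ ≃ ℂ × ℂ) (σ : ℂ ≃ ℂ),
        CanonicalCycles.IsPolyAut2 ψ → CanonicalCycles.IsPolyAut1 σ →
        (∀ z, CanonicalCycles.ev N.poly z = σ (CanonicalCycles.ev H (ψ.symm z))) →
        CanonicalCycles.IsGlobalGenerators (CanonicalCycles.genericValues H)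
          (CanonicalCycles.fiber H) (N.gamma ψ σ ρ) := by
  obtain ⟨E, W, R, hE⟩ := N.exists_rectified
  exact ⟨fun c hc => R.bijOn fun h => hc (hE h), R.exists_admissible hE, fun ρ hρ =>
    ⟨R.isGlobalGenerators_alpha hE hρ, R.isGlobalGenerators_delta hE hρ,
      fun H ψ σ hψ hσ h => R.isGlobalGenerators_gamma hE hρ hψ hσ h⟩⟩
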